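/- Let $g(s)=\tfrac{s(s-1)}{2}\pi^{-s/2}\Gamma(s/2)$. For a finite set $B$ of primes let $\zeta_B(s)=\prod_{p\in B}(1-p^{-s})^{-1}$, $\xi_B(s)=g(s)\zeta_B(s)$, $\zeta_B^{:}(s)=s^{|B|}(1-s)^{|B|}\zeta_B(s)$ and $\xi_B^{:}(s)=s^{|B|}(1-s)^{|B|}\xi_B(s)$. Write $\rho_{p,n}=\frac{2n\pi i}{\log p}$ and let \[ \xi_B^{:\mathrm{pp}}(s)=\sum_{p\in B}\sum_{n=-\infty}^{\infty}\frac{\rho_{p,n}(1-\rho_{p,n})\,\xi^{:}_{B\setminus\{p\}}(\rho_{p,n})}{\log p\,(s-\rho_{p,n})}+\sum_{n=1}^{\infty}(-1)^n\frac{2\pi^n(2n+1)\,\zeta_B^{:}(-2n)}{\Gamma(n)\,(s+2n)} \] (terms with $n=0$ in the double sum are $0$) be the principal part of $\xi_B^{:}$. Here the double sum is taken as a whole: it is the limit, as $T\to\infty$ through heights with $\left|\frac{T\log p}{2\pi}-k\right|\ge\frac1{4|B|}$ for all $p\in B$ and $k\in\mathbb Z$, of the sum of all terms with $|\rho_{p,n}|\le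 T$; it equals the termwise sum whenever the individual series converge. Let $\xi_B^{:\mathrm{reg}}$ be the entire function $\xi_B^{:}-\xi_B^{:\mathrm{pp}}$, with removable singularities removed, and put \[ \xi_B^{\approx}(s)=\frac{\xi_B^{:\mathrm{reg}}(s)+\xi_B^{:\mathrm{reg}}(1-s)}{s^{|B|}(1-s)^{|B|}},\qquad \zeta_B^{\approx}(s)=\frac{\xi_B^{\approx}(s)}{g(s)}. \] Theorem. Fix $m\in\mathbb N$ and $s_0\in\mathbb C\setminus\{0,1\}$. As $\min\{p_1,\dots,p_m\}\to\infty$, where $p_1,\dots,p_m$ are distinct primes, $\zeta^{\approx}_{\{p_1,\dots,p_m\}}(s_0)$ converges to a limit $\zeta_{[m]}(s_0)$, and \[ \zeta_{[m]}(s_0)=\frac{1}{s_0^m(1-s_0)^m g(s_0)}\cdot\frac{1}{2\pi i}\int_{(|\Re s_0|+2)}s^m(1-s)^m g(s)\,a(s,s_0)\,ds,\qquad a(s,s_0)=\frac1{s-s_0}+\frac1{s-1+s_0}, \] where the integral is over the upward vertical line $\Re s=|\Re s_0|+2$ and converges absolutely. (At the poles $s_0=-2,-4,\dots$ of $g$,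 $1/g(s_0)$ is read as $0$.) -/

import Mathlib

open Filter Topology

noncomputable section

namespace EulerSieve

/-- The factor `g(s) = s (s - 1) / 2 * π ^ (-s / 2) * Γ(s / 2)`
(`Complex.Gammaℝ s = π ^ (-s / 2) * Γ(s / 2)`). -/
def g (s : ℂ) : ℂ := s * (s - 1) / 2 * Complex.Gammaℝ s

/-- The finite Euler product `ζ_B(s) = ∏_{p ∈ B} 1 / (1 - p ^ (-s))`. -/
def zetaProd (B : Finset ℕ) (s : ℂ) : ℂ := ∏ p ∈ B, 1 / (1 - (p : ℂ) ^ (-s))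

/-- The completed product `ξ_B(s) = g(s) ζ_B(s)`. -/
def xiProd (B : Finset ℕ) (s : ℂ) : ℂ := g s * zetaProd B s

/-- `ζ_B^:(s) = s ^ m (1 - s) ^ m ζ_B(s)`, where `m = |B|`. -/
def zetaColon (B : Finset ℕ) (s : ℂ) : ℂ := s ^ B.card * (1 - s) ^ B.card * zetaProd B s

/-- `ξ_B^:(s) = s ^ m (1 - s) ^ m ξ_B(s)`, where `m = |B|`. -/
def xiColon (B : Finset ℕ) (s : ℂ) : ℂ := s ^ B.card * (1 - s) ^ B.card * xiProd B s

/-- The ghost pole `2 n π i / log p`. -/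
def ghostPole (p : ℕ) (n : ℤ) : ℂ := 2 * n * Real.pi * Complex.I / Real.log p

/-- The summand of the principal part of `ξ_B^:` which belongs to the ghost pole
`2 n π i / log p` (it is `0` for `n = 0`, where `ξ_B^:` has no pole). -/
def ghostTerm (B : Finset ℕ) (p : ℕ) (n : ℤ) (s : ℂ) : ℂ :=
  ghostPole p n * (1 - ghostPole p n) * xiColon (B.erase p) (ghostPole p n) /
    (Real.log p * (s - ghostPole p n))

/-- The sum of the principal parts of `ξ_B^:` at all ghost poles of height at most `T`, that is,
over all `p ∈ B` and all integers `n` with `|2 n π / log p| ≤ T`. -/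
def ghostPartialSum (B : Finset ℕ) (s : ℂ) (T : ℝ) : ℂ :=
  ∑ p ∈ B, ∑ n ∈ Finset.Icc (-(⌊T * Real.log p / (2 * Real.pi)⌋₊ : ℤ))
    (⌊T * Real.log p / (2 * Real.pi)⌋₊ : ℤ), ghostTerm B p n s

/-- The heights `T` that keep away from the heights `2 n π / log p` of all ghost poles:
`T log p / (2 π)` has distance at least `1 / (4 m)` from the integers, for each `p ∈ B`. -/
def goodHeights (B : Finset ℕ) : Set ℝ :=
  {T | ∀ p ∈ B, ∀ n : ℤ, 1 / (4 * (B.card : ℝ)) ≤ |T * Real.log p / (2 * Real.pi) - n|}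

/-- The double series `∑_{p ∈ B} ∑_{n ∈ ℤ}` over the ghost poles in the principal part of `ξ_B^:`,
summed as a whole: all ghost poles up to a common height `T` are taken together, and `T → ∞`
through heights which keep away from the poles.  It is the termwise sum whenever the individual
series over `n` converge, see `ghostPart_eq_sum` and `ghostPart_eq_tsum`. -/
def ghostPart (B : Finset ℕ) (s : ℂ) : ℂ :=
  limUnder (atTop ⊓ 𝓟 (goodHeights B)) (ghostPartialSum B s)

/-- The summand of the principal part of `ξ_B^:` which belongs to the pole `-2 n`, `n ≥ 1`,
of the Gamma factor. -/
def trivialTerm (B : Finset ℕ) (n : ℕ) (s : ℂ) : ℂ :=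
  (-1) ^ n * (2 * (Real.pi : ℂ) ^ n * (2 * n + 1) * zetaColon B (-2 * n)) /
    (Complex.Gamma n * (s + 2 * n))

/-- The principal part of `ξ_B^:`. -/
def xiPrincipal (B : Finset ℕ) (s : ℂ) : ℂ :=
  ghostPart B s + ∑' n : ℕ, trivialTerm B (n + 1) s

/-- The regular part of `ξ_B^:`, that is, the entire function `ξ_B^: - ξ_B^{:pp}`
(the punctured limit gives its value at the removable singularities as well). -/
def xiReg (B : Finset ℕ) (s : ℂ) : ℂ :=
  limUnder (𝓝[≠] s) (fun w => xiColon B w - xiPrincipal B w)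

/-- The approximation `ξ_B^≈` to the Riemann xi function. -/
def xiApprox (B : Finset ℕ) (s : ℂ) : ℂ :=
  (xiReg B s + xiReg B (1 - s)) / (s ^ B.card * (1 - s) ^ B.card)

/-- The approximation `ζ_B^≈ = ξ_B^≈ / g` to the Riemann zeta function. -/
def zetaApprox (B : Finset ℕ) (s : ℂ) : ℂ := xiApprox B s / g s

/-- The filter `min {p₁, …, p_m} → ∞` on the `m`-element sets `{p₁, …, p_m}` of primes. -/
def primeSetsAtTop (m : ℕ) : Filter (Finset ℕ) :=
  ⨅ N : ℕ, 𝓟 {B : Finset ℕ | B.card = m ∧ ∀ p ∈ B, p.Prime ∧ N ≤ p}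

/-- The kernel `a(s, s₀) = 1 / (s - s₀) + 1 / (s - 1 + s₀)`. -/
def kernel (s s₀ : ℂ) : ℂ := 1 / (s - s₀) + 1 / (s - 1 + s₀)

/-- The point `c + i t` of the vertical line `Re s = c`. -/
def linePoint (c t : ℝ) : ℂ := c + t * Complex.I

/-- The integral `∫_{(c)} f(s) ds` over the upward vertical line `Re s = c`. -/
def lineIntegral (c : ℝ) (f : ℂ → ℂ) : ℂ := ∫ t : ℝ, f (linePoint c t) * Complex.I

/-- Near any height there are heights which keep away from the ghost poles. -/
theorem goodHeights_unbounded (B : Finset ℕ) (hB : ∀ p ∈ B, p.Prime) (Y : ℝ) :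
    ∃ T ∈ goodHeights B, Y ≤ T := by
  classical
  rcases B.eq_empty_or_nonempty with rfl | hne
  · exact ⟨Y, by simp [goodHeights], le_rfl⟩
  by_contra! hcon
  have hm : 0 < (B.card : ℝ) := by exact_mod_cast hne.card_pos
  have hm1 : 1 ≤ (B.card : ℝ) := by exact_mod_cast hne.card_pos
  set c : ℝ := 1 / (4 * (B.card : ℝ)) with hc
  have hc0 : 0 < c := by positivity
  have hc1 : c < 1 := by
    rw [hc, div_lt_one (by positivity)]; linarith
  let L : ℕ → ℝ := fun p => Real.log p / (2 * Real.pi)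
  have hL : ∀ p ∈ B, 0 < L p := fun p hp =>
    div_pos (Real.log_pos (by exact_mod_cast (hB p hp).one_lt)) (by positivity)
  let K : ℝ := ∑ p ∈ B, 2 * c * (2 / L p)
  have hK : 0 ≤ K := Finset.sum_nonneg fun p hp => by
    have := hL p hp
    positivity
  let Y' : ℝ := max Y 0
  let X : ℝ := 2 * (Y' + K) + 1
  have hY' : 0 ≤ Y' := le_max_right _ _
  have hX : 0 ≤ X := by simp only [X]; linarith
  have hcover : Set.Icc Y' X ⊆ ⋃ p ∈ B, ⋃ n ∈ Finset.range (⌊X * L p⌋₊ + 2),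
      Metric.ball ((n : ℝ) / L p) (c / L p) := by
    intro T hT
    have hTg : T ∉ goodHeights B := fun h =>
      absurd (hcon T h) (not_lt.mpr ((le_max_left _ _).trans hT.1))
    simp only [goodHeights, Set.mem_ofPred_eq, not_forall, not_le] at hTg
    obtain ⟨p, hp, n, hn⟩ := hTg
    have hLp := hL p hp
    rw [mul_div_assoc] at hn
    change |T * L p - n| < c at hn
    obtain ⟨hn1, hn2⟩ := abs_lt.mp hn
    have hT0 : 0 ≤ T := hY'.trans hT.1
    have hTL : 0 ≤ T * L p := by positivity
    have hn0 : (0 : ℤ) ≤ n := by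
      have : (-1 : ℝ) < n := by linarith
      have : (-1 : ℤ) < n := by exact_mod_cast this
      omega
    lift n to ℕ using hn0
    simp only [Int.cast_natCast] at hn hn1 hn2
    simp only [Set.mem_iUnion]
    refine ⟨p, hp, n, ?_, ?_⟩
    · rw [Finset.mem_range]
      have h1 : X * L p < ⌊X * L p⌋₊ + 1 := Nat.lt_floor_add_one _
      have h2 : T * L p ≤ X * L p := mul_le_mul_of_nonneg_right hT.2 hLp.le
      have h3 : (n : ℝ) < ((⌊X * L p⌋₊ + 2 : ℕ) : ℝ) := by push_cast; linarith
      exact_mod_cast h3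
    · rw [Metric.mem_ball, Real.dist_eq, lt_div_iff₀ hLp]
      have : |T - n / L p| * L p = |T * L p - n| := by
        rw [← abs_of_pos hLp, ← abs_mul, abs_of_pos hLp, sub_mul, div_mul_cancel₀ _ hLp.ne']
      rw [this]; exact hn
  have hvol := MeasureTheory.measure_mono (μ := MeasureTheory.volume) hcover
  have hbound : MeasureTheory.volume (⋃ p ∈ B, ⋃ n ∈ Finset.range (⌊X * L p⌋₊ + 2),
      Metric.ball ((n : ℝ) / L p) (c / L p)) ≤ ENNReal.ofReal (X / 2 + K) := by
    calc _ ≤ ∑ p ∈ B, ∑ n ∈ Finset.range (⌊X * L p⌋₊ + 2),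
          MeasureTheory.volume (Metric.ball ((n : ℝ) / L p) (c / L p)) :=
          (MeasureTheory.measure_biUnion_finset_le _ _).trans
            (Finset.sum_le_sum fun p _ => MeasureTheory.measure_biUnion_finset_le _ _)
      _ = ∑ p ∈ B, ENNReal.ofReal ((⌊X * L p⌋₊ + 2) * (2 * (c / L p))) := by
          refine Finset.sum_congr rfl fun p hp => ?_
          simp only [Real.volume_ball, Finset.sum_const, Finset.card_range, nsmul_eq_mul]
          rw [← ENNReal.ofReal_natCast, ← ENNReal.ofReal_mul (by positivity)]
          push_cast
          rfl
      _ = ENNReal.ofReal (∑ p ∈ B, (⌊X * L p⌋₊ + 2) * (2 * (c / L p))) := by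
          rw [ENNReal.ofReal_sum_of_nonneg]
          intro p hp
          have := hL p hp
          positivity
      _ ≤ _ := by
          apply ENNReal.ofReal_le_ofReal
          calc ∑ p ∈ B, ((⌊X * L p⌋₊ : ℝ) + 2) * (2 * (c / L p))
              ≤ ∑ p ∈ B, (2 * c * X + 2 * c * (2 / L p)) := by
                refine Finset.sum_le_sum fun p hp => ?_
                have hLp := hL p hp
                have h1 : (⌊X * L p⌋₊ : ℝ) ≤ X * L p := Nat.floor_le (by positivity)
                calc ((⌊X * L p⌋₊ : ℝ) + 2) * (2 * (c / L p))
                    ≤ (X * L p + 2) * (2 * (c / L p)) := by gcongr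
                  _ = _ := by field_simp
            _ = X / 2 + K := by
                rw [Finset.sum_add_distrib, Finset.sum_const, nsmul_eq_mul, hc]
                congr 1
                field_simp
                norm_num
  rw [Real.volume_Icc] at hvol
  have hfin := (ENNReal.ofReal_le_ofReal_iff (by positivity)).mp (hvol.trans hbound)
  simp only [X] at hfin
  linarith

/-- Letting `T → ∞` through `goodHeights B` is a proper limiting process. -/
theorem goodHeights_neBot (B : Finset ℕ) (hB : ∀ p ∈ B, p.Prime) :
    (atTop ⊓ 𝓟 (goodHeights B)).NeBot := by
  rw [← frequently_mem_iff_neBot, frequently_atTop]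
  intro Y
  obtain ⟨T, hT, hY⟩ := goodHeights_unbounded B hB Y
  exact ⟨T, hY, hT⟩

/-- If the series over the ghost poles of each prime converges (even conditionally, in the sense
of symmetric partial sums), then `ghostPart` is the sum of these series. -/
theorem ghostPart_eq_sum (B : Finset ℕ) (hB : ∀ p ∈ B, p.Prime) (s : ℂ) (S : ℕ → ℂ)
    (hS : ∀ p ∈ B, Tendsto (fun N : ℕ => ∑ n ∈ Finset.Icc (-(N : ℤ)) N, ghostTerm B p n s)
      atTop (𝓝 (S p))) :
    ghostPart B s = ∑ p ∈ B, S p := by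
  have := goodHeights_neBot B hB
  apply Tendsto.limUnder_eq
  refine Tendsto.mono_left ?_ inf_le_left
  refine tendsto_finsetSum _ fun p hp => ?_
  refine (hS p hp).comp (tendsto_nat_floor_atTop.comp ?_)
  have hlog : 0 < Real.log p / (2 * Real.pi) :=
    div_pos (Real.log_pos (by exact_mod_cast (hB p hp).one_lt)) (by positivity)
  simp only [mul_div_assoc]
  exact tendsto_id.atTop_mul_const hlog

/-- If the double series over the ghost poles converges absolutely, then `ghostPart` is its sum
`∑_{p ∈ B} ∑_{n ∈ ℤ}`. -/
theorem ghostPart_eq_tsum (B : Finset ℕ) (hB : ∀ p ∈ B, p.Prime) (s : ℂ)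
    (hs : ∀ p ∈ B, Summable fun n : ℤ => ghostTerm B p n s) :
    ghostPart B s = ∑ p ∈ B, ∑' n : ℤ, ghostTerm B p n s := by
  refine ghostPart_eq_sum B hB s _ fun p hp => ?_
  exact (hs p hp).hasSum.comp Finset.tendsto_Icc_neg

end EulerSieve

end

open EulerSieve

/-!
The regular part of `ξ_B^:` is a Cauchy integral: for `Re s < c` and `c ≥ 1`,
`ξ_B^{:reg}(s) = (2πi)⁻¹ ∫_{(c)} ξ_B^:(w) / (w - s) dw` (`xiReg_eq`).
To see this, apply the residue theorem to `ξ_B^:(w) / (w - s)` on the rectangles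
`[-(2N + 1), c] × [-T, T]` with `N = ⌊T⌋`, where `T` runs through good heights. The residue at `s` is
`ξ_B^:(s)`, and the residues at the ghost poles and at `-2, -4, …, -2N` are minus the corresponding
terms of the principal part (`rectIntegral_xiColon_div`). As `T → ∞` only the right side of the
rectangle survives (`tendsto_rectIntegral`). On the horizontal sides `|1 - p ^ (-w)| ≥ 1 / (2m)`, by the
choice of the heights, while the Gamma factor decays faster than any power of `T`; on the left side
the Gamma factor is superexponentially small and `|ζ_B| ≤ 1`. This also proves that the sum over the
ghost poles converges when taken as a whole, although nothing is known here about the individual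
series, whose terms may have small denominators. All estimates of the Gamma factor come from
iterating `Γ_ℝ(s + 2) = Γ_ℝ(s) s / (2π)`.

Taking `c = |Re s₀| + 2`, which exceeds both `Re s₀` and `Re (1 - s₀)`, and adding the integrals for
`s₀` and `1 - s₀`, one gets `ξ_B^≈(s₀)` as an integral over `(c)` of `ξ_B^:` against `kernel`
(`xiApprox_eq`). In it `B` occurs only through `m` and `ζ_B`. On the line `ζ_B` is bounded by
`2 ^ m` and tends to `1` when all primes of `B` tend to infinity (`tendsto_zetaProd_one`), so
dominated convergence gives the limit.
-/

noncomputable section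

namespace EulerSieve

open Complex

/-! ### The residue theorem on rectangles -/

/-- The counterclockwise integral of `f` over the boundary of the rectangle `[a, b] × [u, v]`. -/
def rectIntegral (f : ℂ → ℂ) (a b u v : ℝ) : ℂ :=
  (∫ x : ℝ in a..b, f (x + u * I)) - (∫ x : ℝ in a..b, f (x + v * I)) +
    I • (∫ y : ℝ in u..v, f (b + y * I)) - I • ∫ y : ℝ in u..v, f (a + y * I)

theorem rectIntegral_eq_zero {f : ℂ → ℂ} {a b u v : ℝ} (hab : a ≤ b) (huv : u ≤ v)
    (hf : ∀ w : ℂ, w.re ∈ Set.Icc a b → w.im ∈ Set.Icc u v → DifferentiableAt ℂ f w) :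
    rectIntegral f a b u v = 0 := by
  have := integral_boundary_rect_eq_zero_of_differentiableOn f ⟨a, u⟩ ⟨b, v⟩ (fun w hw => by
    rw [mem_reProdIm, Set.uIcc_of_le hab, Set.uIcc_of_le huv] at hw
    exact (hf w hw.1 hw.2).differentiableWithinAt)
  simpa [rectIntegral] using this

theorem rectIntegral_congr {f h : ℂ → ℂ} {a b u v : ℝ} (hab : a ≤ b) (huv : u ≤ v)
    (hfh : ∀ w : ℂ, w.re ∈ Set.Icc a b → w.im ∈ Set.Icc u v →
      (w.re = a ∨ w.re = b ∨ w.im = u ∨ w.im = v) → f w = h w) :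
    rectIntegral f a b u v = rectIntegral h a b u v := by
  unfold rectIntegral
  have hab' := Set.uIcc_of_le hab
  have huv' := Set.uIcc_of_le huv
  congr 1
  · congr 1
    · congr 1
      · refine intervalIntegral.integral_congr fun x hx => hfh _ ?_ ?_ ?_ <;> simp_all
      · refine intervalIntegral.integral_congr fun x hx => hfh _ ?_ ?_ ?_ <;> simp_all
    · congr 1
      refine intervalIntegral.integral_congr fun x hx => hfh _ ?_ ?_ ?_ <;> simp_all
  · congr 1
    refine intervalIntegral.integral_congr fun x hx => hfh _ ?_ ?_ ?_ <;> simp_all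

theorem rectIntegral_add {f h : ℂ → ℂ} {a b u v : ℝ} (hab : a ≤ b) (huv : u ≤ v)
    (hf : ∀ w : ℂ, w.re ∈ Set.Icc a b → w.im ∈ Set.Icc u v →
      (w.re = a ∨ w.re = b ∨ w.im = u ∨ w.im = v) → ContinuousAt f w)
    (hh : ∀ w : ℂ, w.re ∈ Set.Icc a b → w.im ∈ Set.Icc u v →
      (w.re = a ∨ w.re = b ∨ w.im = u ∨ w.im = v) → ContinuousAt h w) :
    rectIntegral (fun w => f w + h w) a b u v = rectIntegral f a b u v + rectIntegral h a b u v := by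
  have hab' := Set.uIcc_of_le hab
  have huv' := Set.uIcc_of_le huv
  have key : ∀ k : ℂ → ℂ, (∀ w : ℂ, w.re ∈ Set.Icc a b → w.im ∈ Set.Icc u v →
      (w.re = a ∨ w.re = b ∨ w.im = u ∨ w.im = v) → ContinuousAt k w) →
      (∀ y ∈ ({u, v} : Set ℝ),
        IntervalIntegrable (fun x : ℝ => k (x + y * I)) MeasureTheory.volume a b) ∧
      (∀ x ∈ ({a, b} : Set ℝ),
        IntervalIntegrable (fun y : ℝ => k (x + y * I)) MeasureTheory.volume u v) := by
    intro k hk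
    constructor
    · intro y hy
      apply ContinuousOn.intervalIntegrable
      intro x hx
      refine (ContinuousAt.comp (f := fun x : ℝ => (x + y * I : ℂ)) (hk _ ?_ ?_ ?_)
        (by fun_prop)).continuousWithinAt
      all_goals rcases hy with rfl | rfl <;> simp_all
    · intro x hx
      apply ContinuousOn.intervalIntegrable
      intro y hy
      refine (ContinuousAt.comp (f := fun y : ℝ => (x + y * I : ℂ)) (hk _ ?_ ?_ ?_)
        (by fun_prop)).continuousWithinAt
      all_goals rcases hx with rfl | rfl <;> simp_all
  obtain ⟨f1, f2⟩ := key f hf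
  obtain ⟨h1, h2⟩ := key h hh
  unfold rectIntegral
  rw [intervalIntegral.integral_add (f1 u (by simp)) (h1 u (by simp)),
    intervalIntegral.integral_add (f1 v (by simp)) (h1 v (by simp)),
    intervalIntegral.integral_add (f2 a (by simp)) (h2 a (by simp)),
    intervalIntegral.integral_add (f2 b (by simp)) (h2 b (by simp))]
  simp only [smul_eq_mul]
  ring

/-- The winding number of the boundary of a rectangle around an interior point is `1`. -/
theorem rectIntegral_inv_sub {a b u v : ℝ} {ρ : ℂ} (hre : ρ.re ∈ Set.Ioo a b)
    (him : ρ.im ∈ Set.Ioo u v) :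
    rectIntegral (fun w => 1 / (w - ρ)) a b u v = 2 * Real.pi * I := by
  obtain ⟨ha, hb⟩ := hre
  obtain ⟨hu, hv⟩ := him
  have hor : ∀ y : ℝ, y ≠ ρ.im → ∫ x : ℝ in a..b, 1 / ((x : ℂ) + y * I - ρ) =
      log (b + y * I - ρ) - log (a + y * I - ρ) := by
    intro y hy
    have hslit : ∀ x : ℝ, (x : ℂ) + y * I - ρ ∈ slitPlane := fun x =>
      Or.inr (by simpa [sub_eq_zero] using hy)
    refine intervalIntegral.integral_eq_sub_of_hasDerivAt
      (f := fun x : ℝ => log ((x : ℂ) + y * I - ρ)) (fun x _ => ?_) ?_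
    · exact (((ofRealCLM.hasDerivAt (x := x)).add_const (y * I)).sub_const ρ).clog_real (hslit x)
    · refine (Continuous.div continuous_const (by fun_prop) fun x => ?_).intervalIntegrable _ _
      exact slitPlane_ne_zero (hslit x)
  -- On the left side the branch cut is avoided by `log (-z)` instead of `log z`.
  have ver : ∀ (x : ℝ) (ε : ℂ), ε ^ 2 = 1 → (∀ y : ℝ, ε * ((x : ℂ) + y * I - ρ) ∈ slitPlane) →
      I • ∫ y : ℝ in u..v, 1 / ((x : ℂ) + y * I - ρ) =
      log (ε * (x + v * I - ρ)) - log (ε * (x + u * I - ρ)) := by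
    intro x ε hε hslit
    have hε0 : ε ≠ 0 := by rintro rfl; simp at hε
    rw [← intervalIntegral.integral_smul]
    refine intervalIntegral.integral_eq_sub_of_hasDerivAt
      (f := fun y : ℝ => log (ε * ((x : ℂ) + y * I - ρ))) (fun y _ => ?_) ?_
    · have h := (((((ofRealCLM.hasDerivAt (x := y)).mul_const I).const_add (x : ℂ)).sub_const
        ρ).const_mul ε).clog_real (hslit y)
      have h0 := slitPlane_ne_zero (hslit y)
      have h1 : (x : ℂ) + y * I - ρ ≠ 0 := right_ne_zero_of_mul h0
      refine h.congr_deriv ?_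
      simp only [smul_eq_mul, ofRealCLM_apply, ofReal_one]
      field_simp
    · refine (Continuous.const_smul (Continuous.div continuous_const (by fun_prop) fun y => ?_)
        I).intervalIntegrable _ _
      exact right_ne_zero_of_mul (slitPlane_ne_zero (hslit y))
  unfold rectIntegral
  simp only []
  rw [hor u hu.ne, hor v hv.ne', ver b 1 (by simp) fun y => Or.inl (by simpa using hb),
    ver a (-1) (by simp) fun y => Or.inl (by simpa using ha)]
  have hNW : log (-1 * ((a : ℂ) + v * I - ρ)) = log (a + v * I - ρ) - Real.pi * I := by
    have him : 0 < ((a : ℂ) + v * I - ρ).im := by simpa using hv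
    rw [neg_one_mul, log, log, norm_neg, arg_neg_eq_arg_sub_pi_of_im_pos him]
    push_cast; ring
  have hSW : log (-1 * ((a : ℂ) + u * I - ρ)) = log (a + u * I - ρ) + Real.pi * I := by
    have him : ((a : ℂ) + u * I - ρ).im < 0 := by simpa using hu
    rw [neg_one_mul, log, log, norm_neg, arg_neg_eq_arg_add_pi_of_im_neg him]
    push_cast; ring
  rw [hNW, hSW, one_mul, one_mul]
  ring

/-- A function with a simple pole of residue `0` at `ρ`, in the sense that `(w - ρ) f w → 0`,
becomes differentiable at `ρ` once its value there is corrected. -/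
theorem differentiableAt_update_limUnder {f : ℂ → ℂ} {ρ : ℂ}
    (hd : ∀ᶠ w in 𝓝[≠] ρ, DifferentiableAt ℂ f w)
    (h0 : Tendsto (fun w => (w - ρ) * f w) (𝓝[≠] ρ) (𝓝 0)) :
    DifferentiableAt ℂ (Function.update f ρ (limUnder (𝓝[≠] ρ) f)) ρ := by
  have ho : (fun w => f w - f ρ) =o[𝓝[≠] ρ] fun w => (w - ρ)⁻¹ := by
    rw [Asymptotics.isLittleO_iff_tendsto']
    · have h1 : Tendsto (fun w => (w - ρ) * f ρ) (𝓝[≠] ρ) (𝓝 0) := by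
        have : Tendsto (fun w => (w - ρ) * f ρ) (𝓝 ρ) (𝓝 ((ρ - ρ) * f ρ)) :=
          Continuous.tendsto (by fun_prop) ρ
        simpa using this.mono_left nhdsWithin_le_nhds
      simpa [mul_comm, mul_sub] using h0.sub h1
    · filter_upwards [self_mem_nhdsWithin] with w hw h
      exact absurd (inv_eq_zero.mp h) (sub_ne_zero.mpr hw)
  have hs : {w | DifferentiableAt ℂ f w} ∈ 𝓝[≠] ρ := hd
  have := differentiableOn_update_limUnder_insert_of_isLittleO hs
    (fun w hw => DifferentiableAt.differentiableWithinAt hw) ho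
  refine this.differentiableAt ?_
  rw [mem_nhdsWithin_iff_exists_mem_nhds_inter] at hs
  obtain ⟨U, hU, hUs⟩ := hs
  filter_upwards [hU] with w hw
  by_cases hwρ : w = ρ
  · exact Or.inl hwρ
  · exact Or.inr (hUs ⟨hw, hwρ⟩)

/-- The **residue theorem** for a rectangle and finitely many simple poles (some of which may be
removable singularities, with residue `0`). -/
theorem rectIntegral_eq_sum_residues {a b u v : ℝ} (r : ℂ → ℂ) (S : Finset ℂ)
    (hS : ∀ ρ ∈ S, ρ.re ∈ Set.Ioo a b ∧ ρ.im ∈ Set.Ioo u v) (hab : a ≤ b) (huv : u ≤ v)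
    (f : ℂ → ℂ)
    (hf : ∀ w : ℂ, w.re ∈ Set.Icc a b → w.im ∈ Set.Icc u v → w ∉ S → DifferentiableAt ℂ f w)
    (hr : ∀ ρ ∈ S, Tendsto (fun w => (w - ρ) * f w) (𝓝[≠] ρ) (𝓝 (r ρ))) :
    rectIntegral f a b u v = 2 * Real.pi * I * ∑ ρ ∈ S, r ρ := by
  classical
  -- Induction on the poles: subtracting the principal part at `ρ` leaves a removable singularity.
  induction S using Finset.induction_on generalizing f with
  | empty => simpa using rectIntegral_eq_zero hab huv (fun w h1 h2 => hf w h1 h2 (by simp))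
  | insert ρ S hρ ih =>
    obtain ⟨hρre, hρim⟩ := hS ρ (by simp)
    set f₀ : ℂ → ℂ := fun w => f w - r ρ / (w - ρ) with hf₀
    set f₁ : ℂ → ℂ := Function.update f₀ ρ (limUnder (𝓝[≠] ρ) f₀) with hf₁
    have hpole : ∀ w, w ≠ ρ → DifferentiableAt ℂ (fun w => r ρ / (w - ρ)) w := fun w hw =>
      (differentiableAt_const _).div (by fun_prop) (sub_ne_zero.mpr hw)
    have hf₁eq : ∀ w, w ≠ ρ → f₁ =ᶠ[𝓝 w] f₀ := fun w hw => by
      filter_upwards [isOpen_ne.mem_nhds hw] with z hz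
      exact Function.update_of_ne hz _ _
    have hbd : ∀ w : ℂ, (w.re = a ∨ w.re = b ∨ w.im = u ∨ w.im = v) → w ∉ insert ρ S := by
      intro w hw hwS
      obtain ⟨⟨h1, h2⟩, h3, h4⟩ := hS w hwS
      rcases hw with h | h | h | h <;> linarith
    have hd0 : ∀ᶠ w in 𝓝[≠] ρ, DifferentiableAt ℂ f₀ w := by
      have hU : {w : ℂ | w.re ∈ Set.Ioo a b ∧ w.im ∈ Set.Ioo u v ∧ w ∉ S} ∈ 𝓝 ρ := by
        have hopen : IsOpen {w : ℂ | w.re ∈ Set.Ioo a b ∧ w.im ∈ Set.Ioo u v ∧ w ∉ S} :=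
          (isOpen_Ioo.preimage continuous_re).inter ((isOpen_Ioo.preimage continuous_im).inter
            S.finite_toSet.isClosed.isOpen_compl)
        exact hopen.mem_nhds ⟨hρre, hρim, hρ⟩
      filter_upwards [nhdsWithin_le_nhds hU, self_mem_nhdsWithin] with w hw hwρ
      refine (hf w (Set.Ioo_subset_Icc_self hw.1) (Set.Ioo_subset_Icc_self hw.2.1) ?_).sub
        (hpole w hwρ)
      simp only [Finset.mem_insert, not_or]
      exact ⟨hwρ, hw.2.2⟩
    have hlim0 : Tendsto (fun w => (w - ρ) * f₀ w) (𝓝[≠] ρ) (𝓝 0) := by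
      have h := (hr ρ (by simp)).sub_const (r ρ)
      rw [sub_self] at h
      refine h.congr' ?_
      filter_upwards [self_mem_nhdsWithin] with w hw
      have : w - ρ ≠ 0 := sub_ne_zero.mpr hw
      simp only [hf₀]
      field_simp
    have ih' := ih (fun z hz => hS z (Finset.mem_insert_of_mem hz)) f₁ (fun w h1 h2 hwS => by
        by_cases hw : w = ρ
        · rw [hw]
          exact differentiableAt_update_limUnder hd0 hlim0
        · rw [(hf₁eq w hw).differentiableAt_iff]
          exact (hf w h1 h2 (by simp [hw, hwS])).sub (hpole w hw))
      (fun z hz => by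
        have hzρ : z ≠ ρ := fun h => hρ (h ▸ hz)
        have h1 : Tendsto (fun w => (w - z) * (r ρ / (w - ρ))) (𝓝[≠] z) (𝓝 0) := by
          have : ContinuousAt (fun w => (w - z) * (r ρ / (w - ρ))) z :=
            ContinuousAt.mul (by fun_prop) (hpole z hzρ).continuousAt
          simpa using this.tendsto.mono_left nhdsWithin_le_nhds
        have h2 := (hr z (Finset.mem_insert_of_mem hz)).sub h1
        rw [sub_zero] at h2
        refine h2.congr' ?_
        filter_upwards [nhdsWithin_le_nhds (hf₁eq z hzρ)] with w hw
        rw [hw, ← mul_sub])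
    have hsplit : rectIntegral f a b u v =
        rectIntegral (fun w => f₁ w + r ρ * (1 / (w - ρ))) a b u v := by
      refine rectIntegral_congr hab huv fun w _ _ h3 => ?_
      have hw : w ≠ ρ := fun h => hbd w h3 (by simp [h])
      rw [(hf₁eq w hw).eq_of_nhds]
      simp only [hf₀]
      ring
    have hscal : rectIntegral (fun w => r ρ * (1 / (w - ρ))) a b u v =
        r ρ * rectIntegral (fun w => 1 / (w - ρ)) a b u v := by
      simp only [rectIntegral, intervalIntegral.integral_const_mul, smul_eq_mul]
      ring
    rw [hsplit, rectIntegral_add hab huv, ih', hscal, rectIntegral_inv_sub hρre hρim,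
      Finset.sum_insert hρ]
    · ring
    · intro w h1 h2 h3
      have hwS := hbd w h3
      have hw : w ≠ ρ := fun h => hwS (by simp [h])
      exact (((hf w h1 h2 hwS).sub (hpole w hw)).congr_of_eventuallyEq (hf₁eq w hw)).continuousAt
    · intro w _ _ h3
      have hw : w ≠ ρ := fun h => hbd w h3 (by simp [h])
      simpa [div_eq_mul_inv] using (hpole w hw).continuousAt

/-! ### Decay and residues of the Gamma factor -/

theorem norm_Gamma_le_Gamma_re {s : ℂ} (hs : 0 < s.re) : ‖Complex.Gamma s‖ ≤ Real.Gamma s.re := by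
  rw [Complex.Gamma_eq_integral hs, Real.Gamma_eq_integral hs, Complex.GammaIntegral]
  refine (MeasureTheory.norm_integral_le_integral_norm _).trans_eq ?_
  refine MeasureTheory.setIntegral_congr_fun measurableSet_Ioi fun x hx => ?_
  have hx : 0 < x := hx
  simp only [norm_mul, norm_cpow_eq_rpow_re_of_pos hx, sub_re, one_re]
  rw [norm_real, Real.norm_of_nonneg (Real.exp_pos _).le]

theorem norm_Gammaℝ_le {s : ℂ} (hs : 0 < s.re) : ‖Gammaℝ s‖ ≤ Real.Gamma (s.re / 2) := by
  have hre : (s / 2).re = s.re / 2 := by simp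
  rw [Gammaℝ_def, norm_mul, norm_cpow_eq_rpow_re_of_pos Real.pi_pos]
  have h1 : Real.pi ^ (-s / 2).re ≤ 1 := by
    apply Real.rpow_le_one_of_one_le_of_nonpos (by linarith [Real.pi_gt_three])
    simp; linarith
  have h2 := norm_Gamma_le_Gamma_re (s := s / 2) (by rw [hre]; linarith)
  rw [hre] at h2
  calc _ ≤ 1 * Real.Gamma (s.re / 2) := by gcongr
    _ = _ := one_mul _

theorem norm_Gammaℝ_eq {s : ℂ} (hs : s ≠ 0) :
    ‖Gammaℝ s‖ = ‖Gammaℝ (s + 2)‖ * (2 * Real.pi / ‖s‖) := by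
  have : ‖s‖ ≠ 0 := norm_ne_zero_iff.mpr hs
  have hπ := Real.pi_pos
  rw [Gammaℝ_add_two hs, norm_div, norm_div, norm_mul, norm_real, Real.norm_of_nonneg hπ.le]
  simp only [RCLike.norm_ofNat]
  field_simp

/-- Each step to the right by `2` gains a factor `2 π / ‖s‖`; this is the only source of decay of
`Gammaℝ` used below, so that Stirling's formula is not needed. -/
theorem norm_Gammaℝ_le_iterate {τ : ℝ} (hτ : 0 < τ) (j : ℕ) (s : ℂ)
    (h : ∀ i < j, τ ≤ ‖s + 2 * i‖) :
    ‖Gammaℝ s‖ ≤ ‖Gammaℝ (s + 2 * j)‖ * (2 * Real.pi / τ) ^ j := by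
  induction j with
  | zero => simp
  | succ j ih =>
    have hj := h j (by simp)
    have hj0 : s + 2 * j ≠ 0 := norm_pos_iff.mp (hτ.trans_le hj)
    have hπ := Real.pi_pos
    calc ‖Gammaℝ s‖ ≤ ‖Gammaℝ (s + 2 * j)‖ * (2 * Real.pi / τ) ^ j :=
          ih fun i hi => h i (hi.trans (by simp))
      _ = ‖Gammaℝ (s + 2 * (j + 1 : ℕ))‖ * (2 * Real.pi / ‖s + 2 * j‖) * (2 * Real.pi / τ) ^ j := by
          rw [norm_Gammaℝ_eq hj0]
          congr 4
          push_cast; ring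
      _ ≤ ‖Gammaℝ (s + 2 * (j + 1 : ℕ))‖ * (2 * Real.pi / τ) * (2 * Real.pi / τ) ^ j := by gcongr
      _ = _ := by ring

/-- `Gammaℝ` decays faster than any power of `‖s‖` on vertical lines in the right half plane. -/
theorem norm_Gammaℝ_mul_pow_le {s : ℂ} (hs : 0 < s.re) (k : ℕ) :
    ‖Gammaℝ s‖ ≤ Real.Gamma (s.re / 2 + k) * (2 * Real.pi) ^ k / ‖s‖ ^ k := by
  have hs0 : 0 < ‖s‖ := norm_pos_iff.mpr fun h => by simp [h] at hs
  have hπ := Real.pi_pos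
  have h1 := norm_Gammaℝ_le_iterate hs0 k s fun i _ => by
    rw [← sq_le_sq₀ (norm_nonneg _) (norm_nonneg _), ← normSq_eq_norm_sq, ← normSq_eq_norm_sq,
      normSq_apply, normSq_apply]
    have : (0 : ℝ) ≤ i := by positivity
    simp
    nlinarith
  have h2 := norm_Gammaℝ_le (s := s + 2 * k) (by simp; positivity)
  have h3 : (s + 2 * k).re / 2 = s.re / 2 + k := by simp; ring
  rw [h3] at h2
  calc _ ≤ Real.Gamma (s.re / 2 + k) * (2 * Real.pi / ‖s‖) ^ k := h1.trans (by gcongr)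
    _ = _ := by rw [div_pow, mul_div_assoc]

/-- `Gammaℝ` decays faster than any power of the height, uniformly in a left half plane. -/
theorem exists_norm_Gammaℝ_le_of_re_le (c : ℝ) (k : ℕ) : ∃ C : ℝ, 0 ≤ C ∧ ∀ s : ℂ, s.re ≤ c →
    2 * Real.pi ≤ |s.im| → ‖Gammaℝ s‖ ≤ C / |s.im| ^ k := by
  have hπ := Real.pi_pos
  set M : ℝ := |c| + 2 * k + 4 with hM
  have hM4 : 4 ≤ M := by
    have := abs_nonneg c
    have : (0 : ℝ) ≤ k := by positivity
    linarith
  refine ⟨Real.Gamma ((M + 2) / 2) * (2 * Real.pi) ^ k, ?_, fun s hs him => ?_⟩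
  · have := Real.Gamma_pos_of_pos (s := (M + 2) / 2) (by linarith)
    positivity
  have him0 : 0 < |s.im| := by linarith
  -- At least `k` steps by `2` lead into the strip `[M, M + 2)`, where `Gammaℝ` is bounded.
  set j : ℕ := ⌈(M - s.re) / 2⌉₊ with hj
  have hlo : (M - s.re) / 2 ≤ j := Nat.le_ceil _
  have hk : (k : ℝ) ≤ (M - s.re) / 2 := by
    have := le_abs_self c
    linarith
  have hhi : (j : ℝ) < (M - s.re) / 2 + 1 := Nat.ceil_lt_add_one ((Nat.cast_nonneg k).trans hk)
  have hkj : k ≤ j := by exact_mod_cast hk.trans hlo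
  have h1 := norm_Gammaℝ_le_iterate him0 j s fun i _ => by
    have := abs_im_le_norm (s + 2 * i)
    simpa using this
  have hre : (s + 2 * j).re = s.re + 2 * j := by simp
  have h2 := norm_Gammaℝ_le (s := s + 2 * j) (by rw [hre]; linarith)
  have h3 : Real.Gamma ((s + 2 * j).re / 2) ≤ Real.Gamma ((M + 2) / 2) := by
    apply Real.Gamma_strictMonoOn_Ici.monotoneOn <;> rw [hre] at * <;>
      first | exact Set.mem_Ici.mpr (by linarith) | linarith
  have h4 : (2 * Real.pi / |s.im|) ^ j ≤ (2 * Real.pi / |s.im|) ^ k :=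
    pow_le_pow_of_le_one (by positivity) ((div_le_one him0).mpr him) hkj
  calc _ ≤ Real.Gamma ((M + 2) / 2) * (2 * Real.pi / |s.im|) ^ k := by
        refine h1.trans ?_
        have := h2.trans h3
        gcongr
    _ = _ := by rw [div_pow, mul_div_assoc]

/-- `Gammaℝ` is superexponentially small on the vertical lines half way between its poles. -/
theorem norm_Gammaℝ_le_of_re_eq (N : ℕ) (s : ℂ) (hs : s.re = -(2 * N + 1)) :
    ‖Gammaℝ s‖ ≤ Real.Gamma (3 / 2) * (2 * Real.pi) ^ 2 * (Real.pi ^ N / N.factorial) := by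
  have hπ := Real.pi_pos
  have hG := Real.Gamma_pos_of_pos (s := 3 / 2) (by norm_num)
  induction N generalizing s with
  | zero =>
    have hs1 : s.re = -1 := by simpa using hs
    have h1 := norm_Gammaℝ_le_iterate one_pos 2 s fun i hi => by
      refine le_trans ?_ (abs_re_le_norm _)
      interval_cases i <;> (simp [hs1]; try norm_num)
    have h2 := norm_Gammaℝ_le (s := s + 2 * (2 : ℕ)) (by simp [hs1]; norm_num)
    have h3 : (s + 2 * (2 : ℕ)).re / 2 = 3 / 2 := by simp [hs1]; norm_num
    rw [h3] at h2
    simp only [div_one] at h1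
    refine h1.trans ?_
    simp only [pow_zero, Nat.factorial_zero, Nat.cast_one, div_one, mul_one]
    gcongr
  | succ N ih =>
    have hs' : s.re = -(2 * N + 3) := by rw [hs]; push_cast; ring
    have hnorm : 2 * N + 3 ≤ ‖s‖ := by
      have := abs_re_le_norm s
      rw [hs', abs_neg, abs_of_nonneg (by positivity)] at this
      exact this
    have hN : (0 : ℝ) ≤ N := by positivity
    have hs0 : s ≠ 0 := norm_pos_iff.mp (by linarith)
    have h1 := ih (s + 2) (by simp [hs']; ring)
    rw [norm_Gammaℝ_eq hs0]
    have h2 : 2 * Real.pi / ‖s‖ ≤ Real.pi / (N + 1) := by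
      rw [div_le_div_iff₀ (by linarith) (by linarith)]
      nlinarith
    calc _ ≤ Real.Gamma (3 / 2) * (2 * Real.pi) ^ 2 * (Real.pi ^ N / N.factorial) *
          (Real.pi / (N + 1)) := by gcongr
      _ = _ := by
        rw [Nat.factorial_succ]
        push_cast
        field_simp
        ring

/-- The residue of `Gammaℝ` at its pole `-2 n`. -/
theorem tendsto_mul_Gammaℝ (n : ℕ) :
    Tendsto (fun s => (s + 2 * n) * Gammaℝ s) (𝓝[≠] (-(2 * n : ℂ)))
      (𝓝 (2 * (-Real.pi) ^ n / n.factorial)) := by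
  induction n with
  | zero => simpa using Gammaℝ_residue_zero
  | succ n ih =>
    have hshift : Tendsto (fun s : ℂ => s + 2) (𝓝[≠] (-(2 * (n + 1 : ℕ) : ℂ)))
        (𝓝[≠] (-(2 * n : ℂ))) := by
      refine tendsto_nhdsWithin_iff.mpr ⟨?_, ?_⟩
      · have : Tendsto (fun s : ℂ => s + 2) (𝓝 (-(2 * (n + 1 : ℕ) : ℂ)))
            (𝓝 (-(2 * (n + 1 : ℕ) : ℂ) + 2)) := Continuous.tendsto (by fun_prop) _
        refine (this.mono_left nhdsWithin_le_nhds).trans_eq ?_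
        congr 1; push_cast; ring
      · filter_upwards [self_mem_nhdsWithin] with s hs h
        apply hs
        rw [Set.mem_singleton_iff] at h ⊢
        push_cast
        linear_combination h
    have hn : -(2 * (n + 1 : ℕ) : ℂ) ≠ 0 := by
      simp only [ne_eq, neg_eq_zero, mul_eq_zero, OfNat.ofNat_ne_zero, false_or]
      exact_mod_cast Nat.succ_ne_zero n
    have hinv : Tendsto (fun s : ℂ => 2 * Real.pi / s) (𝓝[≠] (-(2 * (n + 1 : ℕ) : ℂ)))
        (𝓝 (2 * Real.pi / (-(2 * (n + 1 : ℕ) : ℂ)))) :=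
      (ContinuousAt.div continuousAt_const continuousAt_id hn).tendsto.mono_left nhdsWithin_le_nhds
    have hprod := (ih.comp hshift).mul hinv
    have heq : (2 * (-Real.pi : ℂ) ^ n / n.factorial) * (2 * Real.pi / (-(2 * (n + 1 : ℕ) : ℂ))) =
        2 * (-Real.pi) ^ (n + 1) / (n + 1).factorial := by
      have h1 : (n : ℂ) + 1 ≠ 0 := by exact_mod_cast Nat.succ_ne_zero n
      have h2 : (n.factorial : ℂ) ≠ 0 := by exact_mod_cast n.factorial_ne_zero
      rw [Nat.factorial_succ]
      push_cast
      field_simp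
      ring
    rw [heq] at hprod
    refine hprod.congr' ?_
    have hne : ∀ᶠ s : ℂ in 𝓝[≠] (-(2 * (n + 1 : ℕ) : ℂ)), s ≠ 0 :=
      nhdsWithin_le_nhds (isOpen_ne.mem_nhds hn)
    filter_upwards [hne] with s hs
    have hπ : (Real.pi : ℂ) ≠ 0 := by exact_mod_cast Real.pi_ne_zero
    simp only [Function.comp, Gammaℝ_add_two hs]
    push_cast
    field_simp
    ring

theorem differentiableAt_Gammaℝ {s : ℂ} (hs : Gammaℝ s ≠ 0) : DifferentiableAt ℂ Gammaℝ s := by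
  have := (differentiable_Gammaℝ_inv s).fun_inv (inv_ne_zero hs)
  simpa using this

/-! ### The Euler factors and their poles -/

theorem ghostPole_eq_ofReal_mul_I (p : ℕ) (n : ℤ) :
    ghostPole p n = ((2 * n * Real.pi / Real.log p : ℝ) : ℂ) * I := by
  rw [ghostPole]; push_cast; ring

theorem ghostPole_re (p : ℕ) (n : ℤ) : (ghostPole p n).re = 0 := by
  rw [ghostPole_eq_ofReal_mul_I, re_ofReal_mul, I_re, mul_zero]

theorem ghostPole_im (p : ℕ) (n : ℤ) : (ghostPole p n).im = 2 * n * Real.pi / Real.log p := by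
  rw [ghostPole_eq_ofReal_mul_I, mul_I_im, ofReal_re]

theorem log_pos_of_prime {p : ℕ} (hp : p.Prime) : 0 < Real.log p :=
  Real.log_pos (by exact_mod_cast hp.one_lt)

theorem ghostPole_injective {p : ℕ} (hp : p.Prime) : Function.Injective (ghostPole p) := by
  intro n k h
  have h2 := congrArg im h
  have := log_pos_of_prime hp
  have := Real.pi_pos
  rw [ghostPole_im, ghostPole_im] at h2
  field_simp at h2
  exact_mod_cast h2

theorem cpow_neg_eq_exp {p : ℕ} (hp : p.Prime) (w : ℂ) :
    (p : ℂ) ^ (-w) = Complex.exp (-(Real.log p * w)) := by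
  rw [cpow_def_of_ne_zero (by exact_mod_cast hp.ne_zero), ← natCast_log, mul_neg]

theorem cpow_neg_eq_one_iff {p : ℕ} (hp : p.Prime) (w : ℂ) :
    (p : ℂ) ^ (-w) = 1 ↔ ∃ n : ℤ, w = ghostPole p n := by
  have hlog : (Real.log p : ℂ) ≠ 0 := by exact_mod_cast (log_pos_of_prime hp).ne'
  rw [cpow_neg_eq_exp hp, Complex.exp_neg, inv_eq_one, Complex.exp_eq_one_iff]
  refine exists_congr fun n => ?_
  rw [ghostPole, eq_div_iff hlog]
  constructor <;> intro h <;> linear_combination h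

theorem norm_cpow_neg {p : ℕ} (hp : p.Prime) (w : ℂ) : ‖(p : ℂ) ^ (-w)‖ = (p : ℝ) ^ (-w.re) := by
  have := norm_natCast_cpow_of_pos hp.pos (-w)
  simpa using this

/-- The ghost poles of different primes differ: logarithms of primes are incommensurable. -/
theorem cpow_neg_ghostPole_ne_one {p q : ℕ} (hp : p.Prime) (hq : q.Prime) (hpq : p ≠ q) {n : ℤ}
    (hn : n ≠ 0) : (q : ℂ) ^ (-ghostPole p n) ≠ 1 := by
  rw [ne_eq, cpow_neg_eq_one_iff hq]
  rintro ⟨k, hk⟩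
  have h2 := congrArg im hk
  have hlp := log_pos_of_prime hp
  have hlq := log_pos_of_prime hq
  have := Real.pi_pos
  rw [ghostPole_im, ghostPole_im] at h2
  field_simp at h2
  have h3 := congrArg abs h2
  rw [abs_mul, abs_mul, abs_of_pos hlp, abs_of_pos hlq, ← Int.cast_abs, ← Int.cast_abs,
    Int.abs_eq_natAbs, Int.abs_eq_natAbs, Int.cast_natCast, Int.cast_natCast] at h3
  have h4 : Real.log ((q : ℝ) ^ n.natAbs) = Real.log ((p : ℝ) ^ k.natAbs) := by
    rw [Real.log_pow, Real.log_pow]; linarith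
  have hp0 : (0 : ℝ) < p := by exact_mod_cast hp.pos
  have hq0 : (0 : ℝ) < q := by exact_mod_cast hq.pos
  have h5 : q ^ n.natAbs = p ^ k.natAbs := by
    exact_mod_cast Real.log_injOn_pos (Set.mem_Ioi.mpr (by positivity))
      (Set.mem_Ioi.mpr (by positivity)) h4
  have h6 : q ∣ p ^ k.natAbs := h5 ▸ dvd_pow_self q (Int.natAbs_ne_zero.mpr hn)
  exact hpq ((Nat.prime_dvd_prime_iff_eq hq hp).mp (hq.dvd_of_dvd_pow h6)).symm

theorem hasDerivAt_one_sub_cpow_neg {p : ℕ} (hp : p.Prime) (w : ℂ) :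
    HasDerivAt (fun w : ℂ => 1 - (p : ℂ) ^ (-w)) (Real.log p * (p : ℂ) ^ (-w)) w := by
  simp only [cpow_neg_eq_exp hp]
  have := ((((hasDerivAt_id w).const_mul (Real.log p : ℂ)).fun_neg).cexp).const_sub 1
  refine this.congr_deriv ?_
  simp only [id]; ring

/-- The Euler factor of `p` has residue `1 / log p` at each of its poles. -/
theorem tendsto_mul_eulerFactor {p : ℕ} (hp : p.Prime) {ρ : ℂ} (hρ : (p : ℂ) ^ (-ρ) = 1) :
    Tendsto (fun w : ℂ => (w - ρ) * (1 / (1 - (p : ℂ) ^ (-w)))) (𝓝[≠] ρ)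
      (𝓝 (1 / Real.log p)) := by
  have hlog : (Real.log p : ℂ) ≠ 0 := by exact_mod_cast (log_pos_of_prime hp).ne'
  have h := hasDerivAt_iff_tendsto_slope.mp (hasDerivAt_one_sub_cpow_neg hp ρ)
  rw [hρ, mul_one] at h
  have h' := h.inv₀ hlog
  rw [← one_div] at h'
  refine h'.congr fun w => ?_
  rw [slope_def_field, hρ, sub_self, sub_zero, inv_div]
  ring

theorem differentiableAt_zetaProd {B : Finset ℕ} (hB : ∀ p ∈ B, p.Prime) {w : ℂ}
    (hw : ∀ p ∈ B, (p : ℂ) ^ (-w) ≠ 1) : DifferentiableAt ℂ (zetaProd B) w := by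
  unfold zetaProd
  refine DifferentiableAt.fun_finsetProd fun p hp => ?_
  exact (differentiableAt_const _).div (hasDerivAt_one_sub_cpow_neg (hB p hp) w).differentiableAt
    (sub_ne_zero.mpr (hw p hp).symm)

/-- The factor `s ^ m (1 - s) ^ m g(s)` common to all `ξ_B^:` with `|B| = m`. -/
def weight (m : ℕ) (s : ℂ) : ℂ := s ^ m * (1 - s) ^ m * g s

theorem xiColon_eq (B : Finset ℕ) (s : ℂ) : xiColon B s = weight B.card s * zetaProd B s := by
  rw [xiColon, xiProd, weight]; ring

theorem differentiableAt_weight (m : ℕ) {w : ℂ} (hw : Gammaℝ w ≠ 0) :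
    DifferentiableAt ℂ (weight m) w := by
  have := differentiableAt_Gammaℝ hw
  unfold weight g
  fun_prop

theorem differentiableAt_xiColon {B : Finset ℕ} (hB : ∀ p ∈ B, p.Prime) {w : ℂ}
    (hG : Gammaℝ w ≠ 0) (hw : ∀ p ∈ B, (p : ℂ) ^ (-w) ≠ 1) : DifferentiableAt ℂ (xiColon B) w := by
  have : xiColon B = fun s => weight B.card s * zetaProd B s := funext (xiColon_eq B)
  rw [this]
  exact (differentiableAt_weight _ hG).mul (differentiableAt_zetaProd hB hw)

theorem norm_zetaProd_le {B : Finset ℕ} {w : ℂ} {δ : ℝ} (hδ : B.Nonempty → 0 < δ)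
    (h : ∀ p ∈ B, δ ≤ ‖1 - (p : ℂ) ^ (-w)‖) : ‖zetaProd B w‖ ≤ (1 / δ) ^ B.card := by
  rw [zetaProd, norm_prod]
  refine (Finset.prod_le_prod (fun p _ => norm_nonneg _) fun p hp => ?_).trans_eq
    (Finset.prod_const (1 / δ))
  rw [norm_div, norm_one]
  exact one_div_le_one_div_of_le (hδ ⟨p, hp⟩) (h p hp)

theorem norm_weight_le (m : ℕ) (w : ℂ) :
    ‖weight m w‖ ≤ (1 + ‖w‖) ^ (2 * m + 2) * ‖Gammaℝ w‖ := by
  have h1 : ‖1 - w‖ ≤ 1 + ‖w‖ := by simpa using norm_sub_le 1 w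
  have h2 : ‖w - 1‖ ≤ 1 + ‖w‖ := by rw [norm_sub_rev]; exact h1
  have h3 : ‖w‖ ≤ 1 + ‖w‖ := by linarith
  have h4 : 0 ≤ 1 + ‖w‖ := by positivity
  simp only [weight, g, norm_mul, norm_pow, norm_div, RCLike.norm_ofNat]
  calc _ ≤ (1 + ‖w‖) ^ m * (1 + ‖w‖) ^ m * ((1 + ‖w‖) * (1 + ‖w‖) / 1 * ‖Gammaℝ w‖) := by
        gcongr; norm_num
    _ = _ := by ring

theorem one_le_norm_one_sub_cpow_neg {p : ℕ} (hp : p.Prime) {w : ℂ} (hw : w.re ≤ -1) :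
    1 ≤ ‖1 - (p : ℂ) ^ (-w)‖ := by
  have h1 : (2 : ℝ) ≤ p := by exact_mod_cast hp.two_le
  have h2 : (p : ℝ) ≤ (p : ℝ) ^ (-w.re) := by
    simpa using Real.rpow_le_rpow_of_exponent_le (x := p) (by linarith) (y := 1) (z := -w.re)
      (by linarith)
  have h3 := norm_sub_norm_le ((p : ℂ) ^ (-w)) 1
  rw [norm_sub_rev, norm_cpow_neg hp, norm_one] at h3
  linarith

theorem norm_cpow_neg_le {p : ℕ} (hp : p.Prime) {w : ℂ} (hw : 1 ≤ w.re) :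
    ‖(p : ℂ) ^ (-w)‖ ≤ 1 / p := by
  have h1 : (1 : ℝ) ≤ p := by exact_mod_cast hp.one_le
  rw [norm_cpow_neg hp, one_div, ← Real.rpow_neg_one]
  exact Real.rpow_le_rpow_of_exponent_le h1 (by linarith)

theorem half_le_norm_one_sub_cpow_neg {p : ℕ} (hp : p.Prime) {w : ℂ} (hw : 1 ≤ w.re) :
    1 / 2 ≤ ‖1 - (p : ℂ) ^ (-w)‖ := by
  have h1 : (2 : ℝ) ≤ p := by exact_mod_cast hp.two_le
  have h2 : (1 : ℝ) / p ≤ 1 / 2 := by gcongr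
  have h3 := norm_sub_norm_le 1 ((p : ℂ) ^ (-w))
  have h4 := norm_cpow_neg_le hp hw
  rw [norm_one] at h3
  linarith

/-- The distance of `1` from a ray through the origin is at least half the distance of `1` from the
point of the ray on the unit circle. -/
theorem half_norm_one_sub_le {r : ℝ} (hr : 0 ≤ r) {z : ℂ} (hz : ‖z‖ = 1) :
    ‖1 - z‖ / 2 ≤ ‖1 - r * z‖ := by
  have h1 : ‖(r : ℂ) * z - z‖ ≤ ‖1 - r * z‖ := by
    rw [← sub_one_mul, norm_mul, hz, mul_one, ← ofReal_one, ← ofReal_sub, norm_real,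
      Real.norm_eq_abs, abs_sub_comm]
    have := abs_norm_sub_norm_le 1 ((r : ℂ) * z)
    simpa [hz, abs_of_nonneg hr] using this
  have h2 : ‖1 - z‖ ≤ ‖1 - r * z‖ + ‖(r : ℂ) * z - z‖ := norm_sub_le_norm_sub_add_norm_sub _ _ _
  linarith

theorem two_mul_le_abs_sin_pi_mul {x δ : ℝ} (h : ∀ n : ℤ, δ ≤ |x - n|) :
    2 * δ ≤ |Real.sin (Real.pi * x)| := by
  have hπ := Real.pi_pos
  set y := x - round x with hy
  have h1 := h (round x)
  have h2 : |y| ≤ 1 / 2 := abs_sub_round x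
  have h3 : |Real.sin (Real.pi * x)| = |Real.sin (Real.pi * y)| := by
    rw [hy, mul_sub, mul_comm Real.pi (round x : ℝ), Real.sin_sub_int_mul_pi, abs_mul, abs_zpow]
    simp
  have h4 := Real.mul_abs_le_abs_sin (x := Real.pi * y) (by
    rw [abs_mul, abs_of_pos hπ]; nlinarith)
  rw [h3]
  refine le_trans ?_ h4
  rw [abs_mul, abs_of_pos hπ]
  have : 2 / Real.pi * (Real.pi * |y|) = 2 * |y| := by field_simp
  rw [this]
  linarith

/-- At good heights `1 - p ^ (-w)` is bounded away from `0`, uniformly in the real part. -/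
theorem le_norm_one_sub_cpow_neg_of_goodHeights {B : Finset ℕ} (hB : ∀ p ∈ B, p.Prime) {T : ℝ}
    (hT : T ∈ goodHeights B) {p : ℕ} (hp : p ∈ B) {w : ℂ} (hw : |w.im| = |T|) :
    1 / (2 * B.card : ℝ) ≤ ‖1 - (p : ℂ) ^ (-w)‖ := by
  have hlog := log_pos_of_prime (hB p hp)
  have hπ := Real.pi_pos
  set x : ℝ := w.im * Real.log p / (2 * Real.pi) with hx
  have hdist : ∀ n : ℤ, 1 / (4 * (B.card : ℝ)) ≤ |x - n| := by
    intro n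
    rcases abs_eq_abs.mp hw with h | h
    · rw [hx, h]; exact hT p hp n
    · have := hT p hp (-n)
      rw [hx, h, ← abs_neg]
      convert this using 2
      push_cast; ring
  have hsin := two_mul_le_abs_sin_pi_mul hdist
  set z : ℂ := Complex.exp ((-(2 * Real.pi * x) : ℝ) * I) with hz
  have hz1 : ‖z‖ = 1 := norm_exp_ofReal_mul_I _
  have hpow : (p : ℂ) ^ (-w) = ((Real.exp (-(Real.log p * w.re)) : ℝ) : ℂ) * z := by
    rw [cpow_neg_eq_exp (hB p hp), ofReal_exp, hz, ← Complex.exp_add, hx]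
    congr 1
    conv_lhs => rw [← re_add_im w]
    have : (Real.pi : ℂ) ≠ 0 := by exact_mod_cast hπ.ne'
    push_cast
    field_simp
    ring
  have hchord : ‖1 - z‖ = 2 * |Real.sin (Real.pi * x)| := by
    rw [norm_sub_rev, hz, mul_comm _ I, norm_exp_I_mul_ofReal_sub_one]
    rw [Real.norm_eq_abs, abs_mul, abs_two]
    rw [show -(2 * Real.pi * x) / 2 = -(Real.pi * x) by ring, Real.sin_neg, abs_neg]
  rw [hpow]
  refine le_trans ?_ (half_norm_one_sub_le (Real.exp_pos _).le hz1)
  rw [hchord]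
  have : 1 / (2 * B.card : ℝ) = 2 * (1 / (4 * (B.card : ℝ))) := by
    rw [show (4 * (B.card : ℝ)) = 2 * (2 * B.card) by ring, one_div, one_div, mul_inv (2 : ℝ) (2 * _)]
    ring
  linarith

/-! ### The residues of `ξ_B^:` -/

theorem xiColon_eq_erase {B : Finset ℕ} {p : ℕ} (hp : p ∈ B) (w : ℂ) :
    xiColon B w = w * (1 - w) * xiColon (B.erase p) w * (1 / (1 - (p : ℂ) ^ (-w))) := by
  rw [xiColon_eq, xiColon_eq, weight, weight, zetaProd, zetaProd, ← Finset.card_erase_add_one hp,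
    ← Finset.mul_prod_erase B _ hp]
  ring

/-- The residue of `ξ_B^:` at a ghost pole, which is simple because no other prime shares it. -/
theorem tendsto_mul_xiColon_ghostPole {B : Finset ℕ} (hB : ∀ p ∈ B, p.Prime) {p : ℕ} (hp : p ∈ B)
    {n : ℤ} (hn : n ≠ 0) :
    Tendsto (fun w => (w - ghostPole p n) * xiColon B w) (𝓝[≠] (ghostPole p n))
      (𝓝 (ghostPole p n * (1 - ghostPole p n) * xiColon (B.erase p) (ghostPole p n) /
        Real.log p)) := by
  have hρ : (p : ℂ) ^ (-ghostPole p n) = 1 := (cpow_neg_eq_one_iff (hB p hp) _).mpr ⟨n, rfl⟩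
  have hne : ghostPole p n ≠ 0 := by
    intro h
    apply hn
    apply ghostPole_injective (hB p hp)
    rw [h]; simp [ghostPole]
  have hG : Gammaℝ (ghostPole p n) ≠ 0 := by
    intro h
    obtain ⟨k, hk⟩ := Gammaℝ_eq_zero_iff.mp h
    apply hne
    have := congrArg re hk
    rw [ghostPole_re] at this
    have hk0 : (k : ℝ) = 0 := by simpa using this
    rw [hk, show (k : ℂ) = 0 by exact_mod_cast hk0]; simp
  have hd : DifferentiableAt ℂ (xiColon (B.erase p)) (ghostPole p n) :=
    differentiableAt_xiColon (fun q hq => hB q (Finset.mem_of_mem_erase hq)) hG fun q hq =>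
      cpow_neg_ghostPole_ne_one (hB p hp) (hB q (Finset.mem_of_mem_erase hq))
        (Finset.ne_of_mem_erase hq).symm hn
  have hc : ContinuousAt (fun w => w * (1 - w) * xiColon (B.erase p) w) (ghostPole p n) :=
    ContinuousAt.mul (by fun_prop) hd.continuousAt
  have h := (hc.tendsto.mono_left nhdsWithin_le_nhds).mul (tendsto_mul_eulerFactor (hB p hp) hρ)
  rw [mul_one_div] at h
  refine h.congr fun w => ?_
  rw [xiColon_eq_erase hp]
  ring

/-- The residue of `ξ_B^:` at the pole `-2 (n + 1)` of the Gamma factor. -/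
theorem tendsto_mul_xiColon_trivial {B : Finset ℕ} (hB : ∀ p ∈ B, p.Prime) (n : ℕ) :
    Tendsto (fun w => (w + 2 * (n + 1 : ℕ)) * xiColon B w) (𝓝[≠] (-(2 * (n + 1 : ℕ) : ℂ)))
      (𝓝 ((-1) ^ (n + 1) * (2 * (Real.pi : ℂ) ^ (n + 1) * (2 * (n + 1 : ℕ) + 1) *
        zetaColon B (-2 * (n + 1 : ℕ))) / Complex.Gamma (n + 1 : ℕ))) := by
  set ρ : ℂ := -(2 * (n + 1 : ℕ) : ℂ) with hρ
  have hre : ρ.re ≤ -1 := by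
    have : (0 : ℝ) ≤ n := by positivity
    simp [hρ]; linarith
  have hd : DifferentiableAt ℂ (zetaProd B) ρ := differentiableAt_zetaProd hB fun p hp h => by
    have := one_le_norm_one_sub_cpow_neg (hB p hp) hre
    rw [h, sub_self, norm_zero] at this
    linarith
  have hc : ContinuousAt (fun w => w ^ B.card * (1 - w) ^ B.card * (w * (w - 1) / 2) *
      zetaProd B w) ρ := ContinuousAt.mul (by fun_prop) hd.continuousAt
  have h := (hc.tendsto.mono_left nhdsWithin_le_nhds).mul (tendsto_mul_Gammaℝ (n + 1))
  have heq : (ρ ^ B.card * (1 - ρ) ^ B.card * (ρ * (ρ - 1) / 2) * zetaProd B ρ) *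
      (2 * (-Real.pi) ^ (n + 1) / (n + 1).factorial) =
      (-1) ^ (n + 1) * (2 * (Real.pi : ℂ) ^ (n + 1) * (2 * (n + 1 : ℕ) + 1) *
        zetaColon B (-2 * (n + 1 : ℕ))) / Complex.Gamma (n + 1 : ℕ) := by
    have h1 : (n : ℂ) + 1 ≠ 0 := by exact_mod_cast Nat.succ_ne_zero n
    have h2 : (n.factorial : ℂ) ≠ 0 := by exact_mod_cast n.factorial_ne_zero
    have h4 : (-2 * (n + 1 : ℕ) : ℂ) = ρ := by rw [hρ, neg_mul]
    rw [h4, zetaColon, Nat.cast_succ, Complex.Gamma_nat_eq_factorial,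
      Nat.factorial_succ, neg_pow (Real.pi : ℂ)]
    have h3 : ρ * (ρ - 1) = 2 * ((n : ℂ) + 1) * (2 * ((n : ℂ) + 1) + 1) := by
      rw [hρ]; push_cast; ring
    rw [h3]
    push_cast
    field_simp
  rw [heq] at h
  refine h.congr fun w => ?_
  rw [xiColon, xiProd, g]
  ring

/-- The singularity of `ξ_B^:` at `0` is removable: `s ^ m` cancels the pole of `ζ_B`, and the factor
`s` of `g` the pole of `Γ(s / 2)`. -/
theorem tendsto_mul_xiColon_zero {B : Finset ℕ} (hB : ∀ p ∈ B, p.Prime) :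
    Tendsto (fun w => (w - 0) * xiColon B w) (𝓝[≠] 0) (𝓝 0) := by
  have h1 : Tendsto (fun w : ℂ => ∏ p ∈ B, ((1 - w) * ((w - 0) * (1 / (1 - (p : ℂ) ^ (-w))))))
      (𝓝[≠] 0) (𝓝 (∏ p ∈ B, ((1 - 0) * (1 / (Real.log p : ℂ))))) := by
    refine tendsto_finsetProd _ fun p hp => ?_
    refine Tendsto.mul ?_ (tendsto_mul_eulerFactor (hB p hp) (by simp))
    exact (Continuous.tendsto (by fun_prop) (0 : ℂ)).mono_left nhdsWithin_le_nhds
  have h2 : Tendsto (fun w : ℂ => w * (w - 1) / 2) (𝓝[≠] 0) (𝓝 (0 * (0 - 1) / 2)) :=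
    (Continuous.tendsto (by fun_prop) (0 : ℂ)).mono_left nhdsWithin_le_nhds
  have h := (h1.mul h2).mul Gammaℝ_residue_zero
  simp only [zero_mul, zero_div, mul_zero] at h
  refine h.congr fun w => ?_
  simp only [Finset.prod_mul_distrib, Finset.prod_const, sub_zero]
  rw [xiColon_eq, weight, g, zetaProd]
  ring

/-! ### Estimates on the sides of the rectangles -/

theorem linePoint_re (c t : ℝ) : (linePoint c t).re = c := by simp [linePoint]

theorem continuous_linePoint (c : ℝ) : Continuous (linePoint c) := by
  unfold linePoint; fun_prop

theorem continuous_weight_linePoint (m : ℕ) {c : ℝ} (hc : 0 < c) :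
    Continuous fun t => weight m (linePoint c t) :=
  continuous_iff_continuousAt.mpr fun t =>
    ContinuousAt.comp (f := linePoint c) (differentiableAt_weight m
      (Gammaℝ_ne_zero_of_re_pos (by rwa [linePoint_re]))).continuousAt
      (continuous_linePoint c).continuousAt

theorem continuous_zetaProd_linePoint {B : Finset ℕ} (hB : ∀ p ∈ B, p.Prime) {c : ℝ} (hc : 1 ≤ c) :
    Continuous fun t => zetaProd B (linePoint c t) :=
  continuous_iff_continuousAt.mpr fun t =>
    ContinuousAt.comp (f := linePoint c) (differentiableAt_zetaProd hB fun p hp h => by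
      have := half_le_norm_one_sub_cpow_neg (hB p hp) (w := linePoint c t) (by rwa [linePoint_re])
      rw [h, sub_self, norm_zero] at this
      norm_num at this).continuousAt
      (continuous_linePoint c).continuousAt

theorem norm_zetaProd_le_two_pow {B : Finset ℕ} (hB : ∀ p ∈ B, p.Prime) {w : ℂ} (hw : 1 ≤ w.re) :
    ‖zetaProd B w‖ ≤ 2 ^ B.card := by
  simpa using norm_zetaProd_le (δ := 1 / 2) (fun _ => by norm_num) fun p hp =>
    half_le_norm_one_sub_cpow_neg (hB p hp) hw

theorem exists_norm_weight_linePoint_le (m : ℕ) {c : ℝ} (hc : 1 ≤ c) :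
    ∃ K : ℝ, ∀ t, ‖weight m (linePoint c t)‖ ≤ K * (1 + t ^ 2)⁻¹ := by
  -- The exponent `k` is the degree of the polynomial factor of `weight`.
  set k := 2 * m + 2 with hk
  set K : ℝ := 2 ^ k * (Real.Gamma (c / 2 + (k + 2 : ℕ)) * (2 * Real.pi) ^ (k + 2)) with hK
  have hK0 : 0 ≤ K := by
    have := Real.Gamma_pos_of_pos (s := c / 2 + (k + 2 : ℕ)) (by positivity)
    have := Real.pi_pos
    positivity
  refine ⟨K, fun t => ?_⟩
  set w := linePoint c t with hw
  have hre : w.re = c := linePoint_re c t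
  have hsq : ‖w‖ ^ 2 = c ^ 2 + t ^ 2 := by
    rw [← normSq_eq_norm_sq, normSq_apply]
    simp [hw, linePoint]; ring
  have h1 : 1 ≤ ‖w‖ := by
    have := abs_re_le_norm w
    rw [hre] at this
    exact hc.trans ((le_abs_self c).trans this)
  have hΓ := norm_Gammaℝ_mul_pow_le (s := w) (by rw [hre]; linarith) (k + 2)
  rw [hre] at hΓ
  calc ‖weight m w‖ ≤ (1 + ‖w‖) ^ k * ‖Gammaℝ w‖ := norm_weight_le m w
    _ ≤ (2 * ‖w‖) ^ k * (Real.Gamma (c / 2 + (k + 2 : ℕ)) * (2 * Real.pi) ^ (k + 2) /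
        ‖w‖ ^ (k + 2)) := by gcongr; linarith
    _ = K * (‖w‖ ^ 2)⁻¹ := by
        rw [hK]
        have : ‖w‖ ≠ 0 := by positivity
        field_simp
        ring
    _ ≤ K * (1 + t ^ 2)⁻¹ := by
        rw [hsq]
        gcongr
        nlinarith

theorem integrable_weight_mul (m : ℕ) {c : ℝ} (hc : 1 ≤ c) {φ : ℝ → ℂ} (hφ : Continuous φ) {M : ℝ}
    (hM : ∀ t, ‖φ t‖ ≤ M) :
    MeasureTheory.Integrable fun t => weight m (linePoint c t) * φ t := by
  obtain ⟨K, hK⟩ := exists_norm_weight_linePoint_le m hc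
  refine (integrable_inv_one_add_sq.const_mul (K * M)).mono'
    ((continuous_weight_linePoint m (by linarith)).mul hφ).aestronglyMeasurable
    (Eventually.of_forall fun t => ?_)
  rw [norm_mul]
  have h0 := (norm_nonneg _).trans (hK t)
  calc _ ≤ K * (1 + t ^ 2)⁻¹ * M := by
        gcongr
        · exact hK t
        · exact hM t
    _ = _ := by ring

theorem linePoint_sub_ne_zero {c t : ℝ} {s : ℂ} (hs : s.re < c) : linePoint c t - s ≠ 0 := by
  intro h
  have := congrArg re h
  rw [sub_re, linePoint_re, zero_re] at this
  linarith

theorem le_norm_linePoint_sub (c t : ℝ) (s : ℂ) : c - s.re ≤ ‖linePoint c t - s‖ := by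
  have := (le_abs_self _).trans (abs_re_le_norm (linePoint c t - s))
  rwa [sub_re, linePoint_re] at this

theorem integrable_xiColon_div {B : Finset ℕ} (hB : ∀ p ∈ B, p.Prime) {c : ℝ} (hc : 1 ≤ c) {s : ℂ}
    (hs : s.re < c) :
    MeasureTheory.Integrable fun t => xiColon B (linePoint c t) / (linePoint c t - s) := by
  have hpos : 0 < c - s.re := by linarith
  have h := integrable_weight_mul B.card hc (φ := fun t => zetaProd B (linePoint c t) /
    (linePoint c t - s)) ((continuous_zetaProd_linePoint hB hc).div
      ((continuous_linePoint c).sub continuous_const) fun t => linePoint_sub_ne_zero hs)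
    (M := 2 ^ B.card / (c - s.re)) fun t => by
      rw [norm_div]
      gcongr
      · exact norm_zetaProd_le_two_pow hB (by rwa [linePoint_re])
      · exact le_norm_linePoint_sub c t s
  refine h.congr (Eventually.of_forall fun t => ?_)
  simp only [xiColon_eq, mul_div_assoc]

/-- The integrals over the horizontal sides at good heights tend to `0`. The cases `η T = T` and
`η T = -T` are the top and the bottom side. -/
theorem tendsto_horizontal {B : Finset ℕ} (hB : ∀ p ∈ B, p.Prime) (c : ℝ) (s : ℂ) (η : ℝ → ℝ)
    (hη : ∀ T, |η T| = |T|) :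
    Tendsto (fun T : ℝ => ∫ x : ℝ in (-(2 * ⌊T⌋₊ + 1))..c, xiColon B (x + η T * I) /
      (x + η T * I - s)) (atTop ⊓ 𝓟 (goodHeights B)) (𝓝 0) := by
  obtain ⟨C, hC0, hC⟩ := exists_norm_Gammaℝ_le_of_re_le c (2 * B.card + 4)
  set m := B.card with hm
  set Z : ℝ := (1 / (1 / (2 * m))) ^ m with hZ
  have hZ0 : 0 ≤ Z := by positivity
  have hlim : Tendsto (fun T : ℝ => 4 ^ (2 * m + 3) * C * Z / T) (atTop ⊓ 𝓟 (goodHeights B))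
      (𝓝 0) := (tendsto_const_nhds.div_atTop tendsto_id).mono_left inf_le_left
  refine squeeze_zero_norm' ?_ hlim
  have hgood : ∀ᶠ T in atTop ⊓ 𝓟 (goodHeights B), T ∈ goodHeights B :=
    mem_inf_of_right (mem_principal_self _)
  filter_upwards [(eventually_ge_atTop (7 : ℝ)).filter_mono inf_le_left,
    (eventually_ge_atTop (|c| + 2)).filter_mono inf_le_left,
    (eventually_ge_atTop (|s.im| + 1)).filter_mono inf_le_left, hgood] with T h7 hTc hTs hT
  have hT0 : 0 < T := by linarith
  have hfl : (⌊T⌋₊ : ℝ) ≤ T := Nat.floor_le hT0.le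
  have hfl0 : (0 : ℝ) ≤ ⌊T⌋₊ := by positivity
  have hηT : |η T| = T := by rw [hη, abs_of_pos hT0]
  obtain ⟨hc1, hc2⟩ := abs_le.mp (le_refl |c|)
  have hac : (-(2 * ⌊T⌋₊ + 1) : ℝ) ≤ c := by
    have : T < ⌊T⌋₊ + 1 := Nat.lt_floor_add_one T
    linarith
  have hbound : ∀ x ∈ Set.uIoc (-(2 * ⌊T⌋₊ + 1) : ℝ) c,
      ‖xiColon B (x + η T * I) / (x + η T * I - s)‖ ≤ 4 ^ (2 * m + 2) * C * Z / T ^ 2 := by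
    intro x hx
    rw [Set.uIoc_of_le hac] at hx
    set w : ℂ := x + η T * I with hw
    have him : w.im = η T := by simp [hw]
    have hre : w.re = x := by simp [hw]
    have hnorm : 1 + ‖w‖ ≤ 4 * T := by
      have h1 := norm_le_abs_re_add_abs_im w
      rw [him, hre, hηT] at h1
      have h2 : |x| ≤ 2 * T + 1 + |c| := abs_le.mpr ⟨by linarith [hx.1], by linarith [hx.2]⟩
      linarith
    have hΓ := hC w (by rw [hre]; exact hx.2) (by rw [him, hηT]; linarith [Real.pi_lt_d2])
    rw [him, hηT] at hΓ
    have hζ : ‖zetaProd B w‖ ≤ Z := norm_zetaProd_le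
      (fun hne => by
        have : (0 : ℝ) < m := by exact_mod_cast hne.card_pos
        positivity)
      fun p hp => le_norm_one_sub_cpow_neg_of_goodHeights hB hT hp (by rw [him, hη])
    have hws : 1 ≤ ‖w - s‖ := by
      have h1 := abs_im_le_norm (w - s)
      have h2 := abs_sub_abs_le_abs_sub w.im s.im
      rw [← sub_im, him, hηT] at h2
      linarith
    rw [norm_div]
    calc ‖xiColon B w‖ / ‖w - s‖ ≤ ‖xiColon B w‖ := div_le_self (norm_nonneg _) hws
      _ = ‖weight m w‖ * ‖zetaProd B w‖ := by rw [xiColon_eq, norm_mul]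
      _ ≤ ((1 + ‖w‖) ^ (2 * m + 2) * ‖Gammaℝ w‖) * Z := by
          gcongr
          exact norm_weight_le m w
      _ ≤ ((4 * T) ^ (2 * m + 2) * (C / T ^ (2 * m + 4))) * Z := by gcongr
      _ = _ := by field_simp; ring
  refine (intervalIntegral.norm_integral_le_of_norm_le_const hbound).trans ?_
  have hlen : |c - (-(2 * ⌊T⌋₊ + 1) : ℝ)| ≤ 4 * T := by
    rw [abs_of_nonneg (by linarith)]; linarith
  calc _ ≤ 4 ^ (2 * m + 2) * C * Z / T ^ 2 * (4 * T) := by gcongr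
    _ = _ := by field_simp; ring

/-- The integrals over the left sides tend to `0`. These sides run half way between the poles of the
Gamma factor, where it is of size `π ^ N / N!`. -/
theorem tendsto_left {B : Finset ℕ} (hB : ∀ p ∈ B, p.Prime) (s : ℂ) :
    Tendsto (fun T : ℝ => ∫ y : ℝ in (-T)..T, xiColon B ((-(2 * ⌊T⌋₊ + 1) : ℝ) + y * I) /
      ((-(2 * ⌊T⌋₊ + 1) : ℝ) + y * I - s)) atTop (𝓝 0) := by
  set m := B.card with hm
  set C : ℝ := Real.Gamma (3 / 2) * (2 * Real.pi) ^ 2 with hC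
  have hC0 : 0 ≤ C := by
    have := Real.Gamma_pos_of_pos (s := 3 / 2) (by norm_num)
    positivity
  have hπ := Real.pi_pos
  have hlim : Tendsto (fun T : ℝ => (2 * m + 3).factorial * Real.exp 3 * C *
      ((Real.exp 3 * Real.pi) ^ ⌊T⌋₊ / (⌊T⌋₊).factorial)) atTop (𝓝 0) := by
    have := ((FloorSemiring.tendsto_pow_div_factorial_atTop (Real.exp 3 * Real.pi)).comp
      (tendsto_nat_floor_atTop (α := ℝ))).const_mul ((2 * m + 3).factorial * Real.exp 3 * C)
    simpa using this
  refine squeeze_zero_norm' ?_ hlim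
  filter_upwards [eventually_ge_atTop (|s.re| + 1)] with T hTs
  have hs0 := abs_nonneg s.re
  have hT0 : 0 < T := by linarith
  set N := ⌊T⌋₊ with hN
  have hfl : (N : ℝ) ≤ T := Nat.floor_le hT0.le
  have hfl' : T < N + 1 := Nat.lt_floor_add_one T
  have hN0 : (0 : ℝ) ≤ N := by positivity
  have hbound : ∀ y ∈ Set.uIoc (-T) T, ‖xiColon B ((-(2 * N + 1) : ℝ) + y * I) /
      ((-(2 * N + 1) : ℝ) + y * I - s)‖ ≤
      (3 * N + 3) ^ (2 * m + 2) * (C * (Real.pi ^ N / N.factorial)) := by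
    intro y hy
    rw [Set.uIoc_of_le (by linarith)] at hy
    set w : ℂ := ((-(2 * N + 1) : ℝ) : ℂ) + y * I with hw
    have him : w.im = y := by rw [hw, add_im, ofReal_im, im_ofReal_mul, I_im]; ring
    have hre : w.re = -(2 * N + 1) := by rw [hw, add_re, ofReal_re, re_ofReal_mul, I_re]; ring
    have hnorm : 1 + ‖w‖ ≤ 3 * N + 3 := by
      have h1 := norm_le_abs_re_add_abs_im w
      rw [him, hre, abs_neg, abs_of_nonneg (by positivity : (0 : ℝ) ≤ 2 * N + 1)] at h1
      have h2 : |y| ≤ T := abs_le.mpr ⟨hy.1.le, hy.2⟩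
      linarith
    have hζ : ‖zetaProd B w‖ ≤ 1 := by
      simpa using norm_zetaProd_le (δ := 1) (fun _ => one_pos) fun p hp =>
        one_le_norm_one_sub_cpow_neg (hB p hp) (w := w) (by rw [hre]; linarith)
    have hws : 1 ≤ ‖w - s‖ := by
      have h1 := abs_re_le_norm (w - s)
      have h2 := abs_sub_abs_le_abs_sub w.re s.re
      rw [← sub_re, hre, abs_neg, abs_of_nonneg (by positivity : (0 : ℝ) ≤ 2 * N + 1)] at h2
      linarith
    rw [norm_div]
    calc ‖xiColon B w‖ / ‖w - s‖ ≤ ‖xiColon B w‖ := div_le_self (norm_nonneg _) hws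
      _ = ‖weight m w‖ * ‖zetaProd B w‖ := by rw [xiColon_eq, norm_mul]
      _ ≤ ((1 + ‖w‖) ^ (2 * m + 2) * ‖Gammaℝ w‖) * 1 := by
          gcongr
          exact norm_weight_le m w
      _ ≤ ((3 * N + 3) ^ (2 * m + 2) * (C * (Real.pi ^ N / N.factorial))) * 1 := by
          gcongr
          exact norm_Gammaℝ_le_of_re_eq N w hre
      _ = _ := mul_one _
  refine (intervalIntegral.norm_integral_le_of_norm_le_const hbound).trans ?_
  have hlen : |T - -T| ≤ 3 * N + 3 := by
    rw [abs_of_nonneg (by linarith)]; linarith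
  have hexp : (3 * (N : ℝ) + 3) ^ (2 * m + 3) ≤
      (2 * m + 3).factorial * (Real.exp 3 * Real.exp 3 ^ N) := by
    have h := Real.pow_div_factorial_le_exp (3 * (N : ℝ) + 3) (by positivity) (2 * m + 3)
    rw [div_le_iff₀ (by positivity)] at h
    have he : Real.exp 3 * Real.exp 3 ^ N = Real.exp (3 * N + 3) := by
      rw [← Real.exp_nat_mul, ← Real.exp_add]; ring_nf
    rw [he, mul_comm _ (Real.exp _)]
    exact h
  calc _ ≤ (3 * (N : ℝ) + 3) ^ (2 * m + 2) * (C * (Real.pi ^ N / N.factorial)) * (3 * N + 3) := by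
        gcongr
    _ = (3 * (N : ℝ) + 3) ^ (2 * m + 3) * (C * (Real.pi ^ N / N.factorial)) := by ring
    _ ≤ (2 * m + 3).factorial * (Real.exp 3 * Real.exp 3 ^ N) *
        (C * (Real.pi ^ N / N.factorial)) := by gcongr
    _ = _ := by rw [mul_pow]; ring

/-- Only the right side of the rectangles contributes in the limit. -/
theorem tendsto_rectIntegral {B : Finset ℕ} (hB : ∀ p ∈ B, p.Prime) {c : ℝ} (hc : 1 ≤ c) {s : ℂ}
    (hs : s.re < c) :
    Tendsto (fun T : ℝ => rectIntegral (fun w => xiColon B w / (w - s)) (-(2 * ⌊T⌋₊ + 1)) c (-T) T)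
      (atTop ⊓ 𝓟 (goodHeights B)) (𝓝 (lineIntegral c fun w => xiColon B w / (w - s))) := by
  have hbot := tendsto_horizontal hB c s (fun T => -T) (fun T => abs_neg T)
  have htop := tendsto_horizontal hB c s (fun T => T) (fun T => rfl)
  have hleft := (tendsto_left hB s).mono_left
    (inf_le_left : atTop ⊓ 𝓟 (goodHeights B) ≤ atTop)
  have hright := (MeasureTheory.intervalIntegral_tendsto_integral (integrable_xiColon_div hB hc hs)
    tendsto_neg_atTop_atBot tendsto_id).mono_left (inf_le_left : atTop ⊓ 𝓟 (goodHeights B) ≤ atTop)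
  have h := ((hbot.sub htop).add (hright.const_smul I)).sub (hleft.const_smul I)
  simp only [smul_zero, sub_zero, zero_add] at h
  unfold rectIntegral
  rw [lineIntegral, MeasureTheory.integral_mul_const, mul_comm]
  exact h

/-! ### The regular part as a Cauchy integral -/

/-- The indices `n` of the ghost poles of `p` other than `0` of height at most `T`. -/
def ghostIndices (p : ℕ) (T : ℝ) : Finset ℤ :=
  (Finset.Icc (-(⌊T * Real.log p / (2 * Real.pi)⌋₊ : ℤ))
    (⌊T * Real.log p / (2 * Real.pi)⌋₊ : ℤ)).erase 0

/-- The ghost poles other than `0` of height at most `T`. -/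
def ghostPoles (B : Finset ℕ) (T : ℝ) : Finset ℂ :=
  B.biUnion fun p => (ghostIndices p T).image (ghostPole p)

/-- The poles `-2, -4, …, -2 N` of the Gamma factor. -/
def trivialPoles (N : ℕ) : Finset ℂ := (Finset.range N).image fun n : ℕ => -(2 * (n + 1 : ℕ) : ℂ)

theorem mem_ghostPoles {B : Finset ℕ} {T : ℝ} {ρ : ℂ} :
    ρ ∈ ghostPoles B T ↔ ∃ p ∈ B, ∃ n ∈ ghostIndices p T, ghostPole p n = ρ := by
  simp [ghostPoles]

theorem mem_trivialPoles {N : ℕ} {ρ : ℂ} :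
    ρ ∈ trivialPoles N ↔ ∃ n < N, -(2 * (n + 1 : ℕ) : ℂ) = ρ := by
  simp [trivialPoles]

theorem mem_ghostIndices {p : ℕ} (hp : p.Prime) {T : ℝ} (hT : 0 ≤ T) {n : ℤ} :
    n ∈ ghostIndices p T ↔ n ≠ 0 ∧ |(ghostPole p n).im| ≤ T := by
  have hlog := log_pos_of_prime hp
  have hπ := Real.pi_pos
  have h1 : |(ghostPole p n).im| ≤ T ↔ (n.natAbs : ℝ) ≤ T * Real.log p / (2 * Real.pi) := by
    rw [ghostPole_im, abs_div, abs_mul, abs_mul, abs_two, abs_of_pos hlog, abs_of_pos hπ,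
      div_le_iff₀ hlog, le_div_iff₀ (by positivity), Nat.cast_natAbs, Int.cast_abs]
    constructor <;> intro h <;> linarith
  rw [ghostIndices, Finset.mem_erase, Finset.mem_Icc, h1, ← Nat.le_floor_iff (by positivity)]
  omega

/-- At good heights no ghost pole lies on the boundary. -/
theorem abs_im_ghostPole_ne {B : Finset ℕ} (hB : ∀ p ∈ B, p.Prime) {T : ℝ}
    (hT : T ∈ goodHeights B) {p : ℕ} (hp : p ∈ B) (n : ℤ) : |(ghostPole p n).im| ≠ |T| := by
  intro h
  have hle := le_norm_one_sub_cpow_neg_of_goodHeights hB hT hp h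
  rw [(cpow_neg_eq_one_iff (hB p hp) _).mpr ⟨n, rfl⟩, sub_self, norm_zero] at hle
  have : 0 < (B.card : ℝ) := by exact_mod_cast Finset.card_pos.mpr ⟨p, hp⟩
  have : 0 < 1 / (2 * (B.card : ℝ)) := by positivity
  linarith

theorem sum_ghostPoles {B : Finset ℕ} (hB : ∀ p ∈ B, p.Prime) {T : ℝ} (hT : 0 ≤ T) (r : ℂ → ℂ) :
    ∑ ρ ∈ ghostPoles B T, r ρ = ∑ p ∈ B, ∑ n ∈ ghostIndices p T, r (ghostPole p n) := by
  rw [ghostPoles, Finset.sum_biUnion]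
  · exact Finset.sum_congr rfl fun p hp =>
      Finset.sum_image fun a _ b _ h => ghostPole_injective (hB p hp) h
  · intro p hp q hq hpq
    rw [Function.onFun, Finset.disjoint_left]
    intro ρ h1 h2
    obtain ⟨n, hn, rfl⟩ := Finset.mem_image.mp h1
    obtain ⟨k, _, hk⟩ := Finset.mem_image.mp h2
    exact cpow_neg_ghostPole_ne_one (hB p hp) (hB q hq) hpq
      ((mem_ghostIndices (hB p hp) hT).mp hn).1 ((cpow_neg_eq_one_iff (hB q hq) _).mpr ⟨k, hk.symm⟩)

theorem sum_trivialPoles (N : ℕ) (r : ℂ → ℂ) :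
    ∑ ρ ∈ trivialPoles N, r ρ = ∑ n ∈ Finset.range N, r (-(2 * (n + 1 : ℕ) : ℂ)) := by
  refine Finset.sum_image fun a _ b _ h => ?_
  have h' : ((a + 1 : ℕ) : ℂ) = (b + 1 : ℕ) := by
    have := neg_injective h
    exact mul_left_cancel₀ two_ne_zero this
  exact Nat.succ_injective (by exact_mod_cast h')

/-- The residue theorem for `w ↦ ξ_B^:(w) / (w - s)` on a rectangle whose horizontal sides lie at a
good height. The residue at a pole `ρ` of `ξ_B^:` is minus the value at `s` of the principal part
at `ρ`. -/
theorem rectIntegral_xiColon_div {B : Finset ℕ} (hB : ∀ p ∈ B, p.Prime) {c T : ℝ} {N : ℕ} {s : ℂ}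
    (hT : T ∈ goodHeights B) (hG : Gammaℝ s ≠ 0) (hs : ∀ p ∈ B, (p : ℂ) ^ (-s) ≠ 1) (hc : 0 < c)
    (hsc : s.re < c) (hsN : -(2 * N + 1) < s.re) (hsT : |s.im| < T) :
    rectIntegral (fun w => xiColon B w / (w - s)) (-(2 * N + 1)) c (-T) T =
      2 * Real.pi * I * (xiColon B s - ghostPartialSum B s T -
        ∑ n ∈ Finset.range N, trivialTerm B (n + 1) s) := by
  have hT0 : 0 < T := (abs_nonneg _).trans_lt hsT
  have hN0 : (0 : ℝ) ≤ N := by positivity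
  have hs0 : s ≠ 0 := fun h => hG (Gammaℝ_eq_zero_iff.mpr ⟨0, by simp [h]⟩)
  have hs_ghost : ∀ p ∈ B, ∀ n : ℤ, ghostPole p n ≠ s := fun p hp n h =>
    hs p hp ((cpow_neg_eq_one_iff (hB p hp) s).mpr ⟨n, h.symm⟩)
  have hs_triv : ∀ n : ℕ, -(2 * n : ℂ) ≠ s := fun n h => hG (Gammaℝ_eq_zero_iff.mpr ⟨n, h.symm⟩)
  set f : ℂ → ℂ := fun w => xiColon B w / (w - s) with hf
  -- The residues are named as limits, and evaluated at the poles one by one.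
  set r : ℂ → ℂ := fun ρ => limUnder (𝓝[≠] ρ) fun w => (w - ρ) * f w with hr
  have hpole : ∀ {ρ R : ℂ}, ρ ≠ s → Tendsto (fun w => (w - ρ) * xiColon B w) (𝓝[≠] ρ) (𝓝 R) →
      Tendsto (fun w => (w - ρ) * f w) (𝓝[≠] ρ) (𝓝 (R / (ρ - s))) := by
    intro ρ R hρ h
    have hcont : ContinuousAt (fun w : ℂ => w - s) ρ := by fun_prop
    refine (h.div (hcont.tendsto.mono_left nhdsWithin_le_nhds) (sub_ne_zero.mpr hρ)).congr
      fun w => ?_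
    simp only [hf, Pi.div_apply]
    ring
  have hself : Tendsto (fun w => (w - s) * f w) (𝓝[≠] s) (𝓝 (xiColon B s)) := by
    refine ((differentiableAt_xiColon hB hG hs).continuousAt.tendsto.mono_left
      nhdsWithin_le_nhds).congr' ?_
    filter_upwards [self_mem_nhdsWithin] with w hw
    have : w - s ≠ 0 := sub_ne_zero.mpr hw
    simp only [hf]
    field_simp
  have hzero := hpole (Ne.symm hs0) (tendsto_mul_xiColon_zero hB)
  rw [zero_div] at hzero
  have hghost : ∀ p ∈ B, ∀ n : ℤ, n ≠ 0 → Tendsto (fun w => (w - ghostPole p n) * f w)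
      (𝓝[≠] (ghostPole p n)) (𝓝 (-ghostTerm B p n s)) := by
    intro p hp n hn
    have h := hpole (hs_ghost p hp n) (tendsto_mul_xiColon_ghostPole hB hp hn)
    convert h using 2
    rw [ghostTerm, div_div, ← neg_sub s, mul_neg, div_neg]
  have htriv : ∀ n : ℕ, Tendsto (fun w => (w - (-(2 * (n + 1 : ℕ) : ℂ))) * f w)
      (𝓝[≠] (-(2 * (n + 1 : ℕ) : ℂ))) (𝓝 (-trivialTerm B (n + 1) s)) := by
    intro n
    have h := hpole (ρ := -(2 * (n + 1 : ℕ) : ℂ)) (hs_triv (n + 1))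
      (by simpa only [sub_neg_eq_add] using tendsto_mul_xiColon_trivial hB n)
    convert h using 2
    rw [trivialTerm, div_div, ← neg_add', ← div_neg, ← mul_neg, add_comm s]
  -- The origin is a removable singularity of `ξ_B^:`, where its Lean value is a junk value; it is
  -- treated as a pole with residue `0`.
  set S : Finset ℂ := insert s (insert 0 (ghostPoles B T ∪ trivialPoles N)) with hS
  have hmem : ∀ ρ ∈ S, ρ = s ∨ ρ = 0 ∨ (∃ p ∈ B, ∃ n ∈ ghostIndices p T, ghostPole p n = ρ) ∨
      ∃ n < N, -(2 * (n + 1 : ℕ) : ℂ) = ρ := by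
    intro ρ h
    simpa only [hS, Finset.mem_insert, Finset.mem_union, mem_ghostPoles, mem_trivialPoles] using h
  have hrS : ∀ ρ ∈ S, Tendsto (fun w => (w - ρ) * f w) (𝓝[≠] ρ) (𝓝 (r ρ)) := by
    intro ρ h
    rcases hmem ρ h with rfl | rfl | ⟨p, hp, n, hn, rfl⟩ | ⟨n, hn, rfl⟩
    · exact tendsto_nhds_limUnder ⟨_, hself⟩
    · exact tendsto_nhds_limUnder ⟨_, hzero⟩
    · exact tendsto_nhds_limUnder ⟨_, hghost p hp n ((mem_ghostIndices (hB p hp) hT0.le).mp hn).1⟩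
    · exact tendsto_nhds_limUnder ⟨_, htriv n⟩
  have hinside : ∀ ρ ∈ S, ρ.re ∈ Set.Ioo (-(2 * N + 1) : ℝ) c ∧ ρ.im ∈ Set.Ioo (-T) T := by
    intro ρ h
    rcases hmem ρ h with rfl | rfl | ⟨p, hp, n, hn, rfl⟩ | ⟨n, hn, rfl⟩
    · exact ⟨⟨hsN, hsc⟩, abs_lt.mp hsT⟩
    · simp only [zero_re, zero_im, Set.mem_Ioo]
      exact ⟨⟨by linarith, hc⟩, by linarith, hT0⟩
    · have h1 := ((mem_ghostIndices (hB p hp) hT0.le).mp hn).2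
      have h2 := abs_im_ghostPole_ne hB hT hp n
      rw [abs_of_pos hT0] at h2
      refine ⟨?_, abs_lt.mp (lt_of_le_of_ne h1 h2)⟩
      rw [ghostPole_re]
      exact ⟨by linarith, hc⟩
    · have h1 : (n : ℝ) + 1 ≤ N := by exact_mod_cast hn
      have h2 : (0 : ℝ) ≤ n := by positivity
      have hre : (-(2 * (n + 1 : ℕ) : ℂ)).re = -(2 * (n + 1)) := by simp
      have him : (-(2 * (n + 1 : ℕ) : ℂ)).im = 0 := by simp
      rw [hre, him]
      exact ⟨⟨by linarith, by linarith⟩, by linarith, hT0⟩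
  have hdiff : ∀ w : ℂ, w.re ∈ Set.Icc (-(2 * N + 1) : ℝ) c → w.im ∈ Set.Icc (-T) T → w ∉ S →
      DifferentiableAt ℂ f w := by
    intro w hre him hw
    simp only [hS, Finset.mem_insert, Finset.mem_union, mem_ghostPoles, mem_trivialPoles,
      not_or] at hw
    obtain ⟨hws, hw0, hwg, hwt⟩ := hw
    refine (differentiableAt_xiColon hB ?_ ?_).div (by fun_prop) (sub_ne_zero.mpr hws)
    · intro h
      obtain ⟨n, rfl⟩ := Gammaℝ_eq_zero_iff.mp h
      rcases n with _ | n
      · exact hw0 (by simp)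
      · refine hwt ⟨n, ?_, rfl⟩
        have h1 := hre.1
        have h2 : (-(2 * (n + 1 : ℕ) : ℂ)).re = -(2 * (n + 1)) := by simp
        rw [h2] at h1
        have h3 : ((2 * (n + 1) : ℕ) : ℝ) ≤ (2 * N + 1 : ℕ) := by push_cast; linarith
        have h4 : 2 * (n + 1) ≤ 2 * N + 1 := by exact_mod_cast h3
        omega
    · intro p hp h
      obtain ⟨n, rfl⟩ := (cpow_neg_eq_one_iff (hB p hp) w).mp h
      refine hwg ⟨p, hp, n, (mem_ghostIndices (hB p hp) hT0.le).mpr ⟨?_, abs_le.mpr him⟩, rfl⟩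
      rintro rfl
      exact hw0 (by simp [ghostPole])
  rw [rectIntegral_eq_sum_residues r S hinside (by linarith) (by linarith) f hdiff hrS]
  have h1 : s ∉ insert 0 (ghostPoles B T ∪ trivialPoles N) := by
    simp only [Finset.mem_insert, Finset.mem_union, mem_ghostPoles, mem_trivialPoles, not_or]
    refine ⟨hs0, ?_, ?_⟩
    · rintro ⟨p, hp, n, -, h⟩
      exact hs_ghost p hp n h
    · rintro ⟨n, -, h⟩
      exact hs_triv _ h
  have hpre : ∀ n : ℕ, (-(2 * (n + 1 : ℕ) : ℂ)).re ≠ 0 := by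
    intro n h
    have h2 : (-(2 * (n + 1 : ℕ) : ℂ)).re = -(2 * (n + 1)) := by simp
    rw [h2] at h
    have : (0 : ℝ) ≤ n := by positivity
    linarith
  have h2 : (0 : ℂ) ∉ ghostPoles B T ∪ trivialPoles N := by
    simp only [Finset.mem_union, mem_ghostPoles, mem_trivialPoles, not_or]
    refine ⟨?_, ?_⟩
    · rintro ⟨p, hp, n, hn, h⟩
      apply ((mem_ghostIndices (hB p hp) hT0.le).mp hn).1
      apply ghostPole_injective (hB p hp)
      rw [h]; simp [ghostPole]
    · rintro ⟨n, -, h⟩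
      exact hpre n (by rw [h, zero_re])
  have h3 : Disjoint (ghostPoles B T) (trivialPoles N) := by
    rw [Finset.disjoint_left]
    intro ρ hg ht
    obtain ⟨p, _, n, _, rfl⟩ := mem_ghostPoles.mp hg
    obtain ⟨k, _, hk⟩ := mem_trivialPoles.mp ht
    exact hpre k (by rw [hk, ghostPole_re])
  have hgsum : ghostPartialSum B s T = ∑ p ∈ B, ∑ n ∈ ghostIndices p T, ghostTerm B p n s := by
    -- The term `n = 0` vanishes.
    refine Finset.sum_congr rfl fun p _ => (Finset.sum_erase _ ?_).symm
    simp [ghostTerm, ghostPole]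
  have hr_self : r s = xiColon B s := hself.limUnder_eq
  have hr_zero : r 0 = 0 := hzero.limUnder_eq
  have hr_triv : ∀ n : ℕ, r (-(2 * (n + 1 : ℕ) : ℂ)) = -trivialTerm B (n + 1) s :=
    fun n => (htriv n).limUnder_eq
  have hr_ghost : ∑ p ∈ B, ∑ n ∈ ghostIndices p T, r (ghostPole p n) =
      ∑ p ∈ B, ∑ n ∈ ghostIndices p T, -ghostTerm B p n s :=
    Finset.sum_congr rfl fun p hp => Finset.sum_congr rfl fun n hn =>
      (hghost p hp n ((mem_ghostIndices (hB p hp) hT0.le).mp hn).1).limUnder_eq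
  rw [hS, Finset.sum_insert h1, Finset.sum_insert h2, Finset.sum_union h3,
    sum_ghostPoles hB hT0.le, sum_trivialPoles, hr_self, hr_zero, hr_ghost, hgsum]
  simp only [hr_triv, Finset.sum_neg_distrib]
  ring

/-- The series over the poles of the Gamma factor converges absolutely: `1 / Γ(n)` beats the
powers of `π` and of `n`, and `|ζ_B(-2 n)| ≤ 1`. -/
theorem summable_trivialTerm {B : Finset ℕ} (hB : ∀ p ∈ B, p.Prime) (s : ℂ) :
    Summable fun n : ℕ => trivialTerm B (n + 1) s := by
  set k := 2 * B.card + 1 with hk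
  have hsum : Summable fun n : ℕ => 2 * Real.pi * k.factorial * Real.exp 3 *
      ((Real.pi * Real.exp 2) ^ n / n.factorial) :=
    (Real.summable_pow_div_factorial _).mul_left _
  refine hsum.of_norm_bounded_eventually_nat ?_
  filter_upwards [eventually_ge_atTop (⌈|s.re|⌉₊)] with n hn
  have hn0 : (0 : ℝ) ≤ n := by positivity
  have hπ := Real.pi_pos
  have hden : 1 ≤ ‖s + 2 * (n + 1 : ℕ)‖ := by
    have h1 : |s.re| ≤ n := (Nat.le_ceil _).trans (by exact_mod_cast hn)
    have h2 := (le_abs_self _).trans (abs_re_le_norm (s + 2 * (n + 1 : ℕ)))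
    have h3 : (s + 2 * (n + 1 : ℕ)).re = s.re + 2 * (n + 1) := by simp
    rw [h3] at h2
    linarith [neg_abs_le s.re]
  set ρ : ℂ := -2 * (n + 1 : ℕ) with hρ
  have hre : ρ.re = -(2 * (n + 1)) := by simp [hρ]
  have hρn : ‖ρ‖ = 2 * (n + 1) := by
    rw [hρ, norm_mul, norm_neg, RCLike.norm_ofNat, norm_natCast]; push_cast; ring
  have hρ1 : ‖1 - ρ‖ ≤ 2 * n + 3 := by
    have := norm_sub_le 1 ρ
    rw [norm_one, hρn] at this
    linarith
  have hζ : ‖zetaProd B ρ‖ ≤ 1 := by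
    simpa using norm_zetaProd_le (δ := 1) (fun _ => one_pos) fun p hp =>
      one_le_norm_one_sub_cpow_neg (hB p hp) (w := ρ) (by rw [hre]; linarith)
  have hcol : ‖zetaColon B ρ‖ ≤ (2 * n + 3) ^ (2 * B.card) := by
    rw [zetaColon, norm_mul, norm_mul, norm_pow, norm_pow, hρn]
    calc _ ≤ (2 * (n : ℝ) + 3) ^ B.card * (2 * n + 3) ^ B.card * 1 := by
          gcongr; linarith
      _ = _ := by ring
  have hexp : (2 * (n : ℝ) + 3) ^ k ≤ k.factorial * (Real.exp 3 * Real.exp 2 ^ n) := by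
    have h := Real.pow_div_factorial_le_exp (2 * (n : ℝ) + 3) (by positivity) k
    rw [div_le_iff₀ (by positivity)] at h
    have he : Real.exp 3 * Real.exp 2 ^ n = Real.exp (2 * n + 3) := by
      rw [← Real.exp_nat_mul, ← Real.exp_add]; ring_nf
    rw [he, mul_comm _ (Real.exp _)]
    exact h
  have hlin : ‖(2 * (n + 1 : ℕ) + 1 : ℂ)‖ = 2 * n + 3 := by
    have : (2 * (n + 1 : ℕ) + 1 : ℂ) = ((2 * n + 3 : ℕ) : ℂ) := by push_cast; ring
    rw [this, norm_natCast]; push_cast; ring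
  rw [trivialTerm, ← hρ, Nat.cast_succ, Complex.Gamma_nat_eq_factorial, ← Nat.cast_succ]
  simp only [norm_div, norm_mul, norm_pow, norm_neg, norm_one, one_pow, one_mul, RCLike.norm_ofNat,
    norm_natCast, norm_real, Real.norm_of_nonneg hπ.le]
  rw [hlin]
  calc 2 * Real.pi ^ (n + 1) * (2 * n + 3) * ‖zetaColon B ρ‖ / (n.factorial * ‖s + 2 * (n + 1 : ℕ)‖)
      ≤ 2 * Real.pi ^ (n + 1) * (2 * n + 3) * (2 * n + 3) ^ (2 * B.card) / (n.factorial * 1) := by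
        gcongr
    _ = 2 * Real.pi ^ (n + 1) * (2 * n + 3) ^ k / n.factorial := by rw [hk, pow_succ _ (2 * _)]; ring
    _ ≤ 2 * Real.pi ^ (n + 1) * (k.factorial * (Real.exp 3 * Real.exp 2 ^ n)) / n.factorial := by
        gcongr
    _ = _ := by rw [mul_pow]; ring

/-- Away from the poles, the regular part of `ξ_B^:` is a Cauchy integral. -/
theorem xiColon_sub_xiPrincipal {B : Finset ℕ} (hB : ∀ p ∈ B, p.Prime) {c : ℝ} (hc : 1 ≤ c) {s : ℂ}
    (hG : Gammaℝ s ≠ 0) (hs : ∀ p ∈ B, (p : ℂ) ^ (-s) ≠ 1) (hsc : s.re < c) :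
    xiColon B s - xiPrincipal B s =
      1 / (2 * Real.pi * I) * lineIntegral c fun w => xiColon B w / (w - s) := by
  have hne := goodHeights_neBot B hB
  have hπ : (2 * Real.pi * I : ℂ) ≠ 0 := two_pi_I_ne_zero
  have htriv : Tendsto (fun T : ℝ => ∑ n ∈ Finset.range ⌊T⌋₊, trivialTerm B (n + 1) s)
      (atTop ⊓ 𝓟 (goodHeights B)) (𝓝 (∑' n : ℕ, trivialTerm B (n + 1) s)) :=
    ((summable_trivialTerm hB s).hasSum.tendsto_sum_nat.comp
      (tendsto_nat_floor_atTop (α := ℝ))).mono_left inf_le_left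
  have hghost : Tendsto (ghostPartialSum B s) (atTop ⊓ 𝓟 (goodHeights B))
      (𝓝 (xiColon B s - 1 / (2 * Real.pi * I) * (lineIntegral c fun w => xiColon B w / (w - s)) -
        ∑' n : ℕ, trivialTerm B (n + 1) s)) := by
    -- The rectangles `[-(2 ⌊T⌋ + 1), c] × [-T, T]` exhaust the half plane `Re w ≤ c`.
    refine ((((tendsto_rectIntegral hB hc hsc).const_mul (1 / (2 * Real.pi * I))).const_sub
      (xiColon B s)).sub htriv).congr' ?_
    filter_upwards [(eventually_gt_atTop |s.im|).filter_mono inf_le_left,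
      (eventually_gt_atTop |s.re|).filter_mono inf_le_left,
      mem_inf_of_right (mem_principal_self (goodHeights B))] with T hT1 hT2 hT
    rw [rectIntegral_xiColon_div hB hT hG hs (by linarith) hsc ?_ hT1]
    · field_simp
      ring
    · have h1 : T < ⌊T⌋₊ + 1 := Nat.lt_floor_add_one T
      have h2 := neg_abs_le s.re
      have h3 : (0 : ℝ) ≤ ⌊T⌋₊ := by positivity
      linarith
  rw [xiPrincipal, ghostPart, hghost.limUnder_eq]
  ring

/-- The poles of `ξ_B^:` are isolated. -/
theorem eventually_regular {B : Finset ℕ} (hB : ∀ p ∈ B, p.Prime) (s : ℂ) :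
    ∀ᶠ w in 𝓝[≠] s, Gammaℝ w ≠ 0 ∧ ∀ p ∈ B, (p : ℂ) ^ (-w) ≠ 1 := by
  -- The zeros of a nonzero entire function are isolated.
  have key : ∀ D : ℂ → ℂ, Differentiable ℂ D → D 2 ≠ 0 → ∀ᶠ w in 𝓝[≠] s, D w ≠ 0 := by
    intro D hD h2
    have han : AnalyticOnNhd ℂ D Set.univ := fun z _ => hD.analyticAt z
    rcases (han s trivial).eventually_eq_zero_or_eventually_ne_zero with h | h
    · exact absurd (han.eqOn_zero_of_preconnected_of_eventuallyEq_zero isPreconnected_univ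
        trivial h trivial) h2
    · exact h
  have h1 := key _ differentiable_Gammaℝ_inv (inv_ne_zero (Gammaℝ_ne_zero_of_re_pos (by simp)))
  have h2 : ∀ p ∈ B, ∀ᶠ w in 𝓝[≠] s, 1 - (p : ℂ) ^ (-w) ≠ 0 := fun p hp =>
    key _ (fun w => (hasDerivAt_one_sub_cpow_neg (hB p hp) w).differentiableAt) fun h => by
      have := half_le_norm_one_sub_cpow_neg (hB p hp) (w := 2) (by simp)
      rw [h, norm_zero] at this
      norm_num at this
  filter_upwards [h1, (Finset.eventually_all B).mpr h2] with w hw1 hw2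
  exact ⟨fun h => hw1 (by rw [h, inv_zero]), fun p hp h => hw2 p hp (by rw [h, sub_self])⟩

theorem continuousAt_cauchyIntegral {B : Finset ℕ} (hB : ∀ p ∈ B, p.Prime) {c : ℝ} (hc : 1 ≤ c)
    {s : ℂ} (hsc : s.re < c) :
    ContinuousAt (fun z => lineIntegral c fun w => xiColon B w / (w - z)) s := by
  unfold lineIntegral
  set d : ℝ := (s.re + c) / 2 with hd
  have hdc : d < c := by rw [hd]; linarith
  have hnear : ∀ᶠ z : ℂ in 𝓝 s, z.re < d :=
    (isOpen_Iio.preimage continuous_re).mem_nhds <| by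
      simp only [Set.mem_preimage, Set.mem_Iio]
      rw [hd]; linarith
  refine MeasureTheory.continuousAt_of_dominated (bound := fun t =>
    ‖weight B.card (linePoint c t) * (2 ^ B.card / (c - d) : ℝ)‖) ?_ ?_ ?_ ?_
  · filter_upwards [hnear] with z hz
    exact ((integrable_xiColon_div hB hc (hz.trans hdc)).mul_const I).aestronglyMeasurable
  · filter_upwards [hnear] with z hz
    refine Eventually.of_forall fun t => ?_
    have hpos : 0 < c - d := by linarith
    have h1 : c - d ≤ ‖linePoint c t - z‖ := by linarith [le_norm_linePoint_sub c t z]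
    rw [norm_mul, norm_I, mul_one, norm_div, xiColon_eq, norm_mul, norm_mul, mul_div_assoc,
      norm_real, Real.norm_of_nonneg (by positivity)]
    gcongr
    exact norm_zetaProd_le_two_pow hB (by rwa [linePoint_re])
  · exact (integrable_weight_mul B.card hc (φ := fun _ => ((2 ^ B.card / (c - d) : ℝ) : ℂ))
      continuous_const fun _ => le_rfl).norm
  · refine Eventually.of_forall fun t => ?_
    exact (ContinuousAt.div continuousAt_const (by fun_prop) (linePoint_sub_ne_zero hsc)).mul
      continuousAt_const

/-- The Cauchy integral also gives the values of the regular part at the removable singularities,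
by continuity. -/
theorem xiReg_eq {B : Finset ℕ} (hB : ∀ p ∈ B, p.Prime) {c : ℝ} (hc : 1 ≤ c) {s : ℂ}
    (hsc : s.re < c) :
    xiReg B s = 1 / (2 * Real.pi * I) * lineIntegral c fun w => xiColon B w / (w - s) := by
  refine Tendsto.limUnder_eq ?_
  refine (((continuousAt_cauchyIntegral hB hc hsc).const_mul
    (1 / (2 * Real.pi * I))).tendsto.mono_left nhdsWithin_le_nhds).congr' ?_
  have hnear : ∀ᶠ z : ℂ in 𝓝[≠] s, z.re < c :=
    nhdsWithin_le_nhds ((isOpen_Iio.preimage continuous_re).mem_nhds hsc)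
  filter_upwards [eventually_regular hB s, hnear] with z hz hzc
  exact (xiColon_sub_xiPrincipal hB hc hz.1 hz.2 hzc).symm

/-- Symmetrizing the Cauchy integral under `s ↦ 1 - s` produces `kernel`. -/
theorem xiApprox_eq {B : Finset ℕ} (hB : ∀ p ∈ B, p.Prime) {c : ℝ} (hc : 1 ≤ c) {s : ℂ}
    (hs : s.re < c) (hs' : 1 - s.re < c) :
    xiApprox B s = 1 / (s ^ B.card * (1 - s) ^ B.card) * (1 / (2 * Real.pi * I) *
      lineIntegral c fun w => xiColon B w * kernel w s) := by
  have hs1 : (1 - s).re < c := by simpa using hs'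
  rw [xiApprox, xiReg_eq hB hc hs, xiReg_eq hB hc hs1, ← mul_add]
  simp only [lineIntegral]
  rw [← MeasureTheory.integral_add ((integrable_xiColon_div hB hc hs).mul_const I)
    ((integrable_xiColon_div hB hc hs1).mul_const I), div_eq_mul_one_div, mul_comm]
  congr 3
  funext t
  rw [kernel, sub_sub_eq_add_sub, add_sub_right_comm]
  ring

/-! ### The limit of large primes -/

theorem norm_kernel_le {c : ℝ} {s : ℂ} (hs : s.re < c) (hs' : 1 - s.re < c) (t : ℝ) :
    ‖kernel (linePoint c t) s‖ ≤ 1 / (c - s.re) + 1 / (c - (1 - s.re)) := by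
  have h1 := le_norm_linePoint_sub c t s
  have h2 := le_norm_linePoint_sub c t (1 - s)
  rw [sub_re, one_re] at h2
  have hp1 : 0 < c - s.re := by linarith
  have hp2 : 0 < c - (1 - s.re) := by linarith
  rw [kernel, show linePoint c t - 1 + s = linePoint c t - (1 - s) by ring]
  refine (norm_add_le _ _).trans ?_
  rw [norm_div, norm_div, norm_one]
  gcongr

theorem continuous_kernel_linePoint {c : ℝ} {s : ℂ} (hs : s.re < c) (hs' : 1 - s.re < c) :
    Continuous fun t => kernel (linePoint c t) s := by
  have hl := continuous_linePoint c
  have hs1 : (1 - s).re < c := by simpa using hs'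
  unfold kernel
  refine (continuous_const.div (by fun_prop) fun t => linePoint_sub_ne_zero hs).add
    (continuous_const.div (by fun_prop) fun t => ?_)
  rw [show linePoint c t - 1 + s = linePoint c t - (1 - s) by ring]
  exact linePoint_sub_ne_zero hs1

theorem eventually_primeSetsAtTop (m N : ℕ) :
    ∀ᶠ B in primeSetsAtTop m, B.card = m ∧ ∀ p ∈ B, p.Prime ∧ N ≤ p :=
  mem_iInf_of_mem N (mem_principal_self _)

instance (m : ℕ) : (primeSetsAtTop m).IsCountablyGenerated := by
  unfold primeSetsAtTop; infer_instance

/-- Right of `Re s = 1` the finite Euler products tend to `1` as all primes become large. -/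
theorem tendsto_zetaProd_one (m : ℕ) {w : ℂ} (hw : 1 ≤ w.re) :
    Tendsto (fun B => zetaProd B w) (primeSetsAtTop m) (𝓝 1) := by
  rw [tendsto_iff_norm_sub_tendsto_zero]
  have hbound : ∀ N : ℕ, 0 < N → ∀ B : Finset ℕ, (B.card = m ∧ ∀ p ∈ B, p.Prime ∧ N ≤ p) →
      ‖zetaProd B w - 1‖ ≤ Real.exp (2 * m / N) - 1 := by
    rintro N hN B ⟨hcard, hB⟩
    set f : ℕ → ℂ := fun p => (p : ℂ) ^ (-w) / (1 - (p : ℂ) ^ (-w)) with hf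
    have hne : ∀ p ∈ B, 1 - (p : ℂ) ^ (-w) ≠ 0 := fun p hp h => by
      have := half_le_norm_one_sub_cpow_neg (hB p hp).1 hw
      rw [h, norm_zero] at this
      norm_num at this
    have hprod : zetaProd B w = ∏ p ∈ B, (1 + f p) := by
      refine Finset.prod_congr rfl fun p hp => ?_
      have := hne p hp
      simp only [hf]
      field_simp
      ring
    have hsum : ∑ p ∈ B, ‖f p‖ ≤ 2 * m / N := by
      calc ∑ p ∈ B, ‖f p‖ ≤ ∑ p ∈ B, (2 / N : ℝ) := by
            refine Finset.sum_le_sum fun p hp => ?_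
            have h1 := half_le_norm_one_sub_cpow_neg (hB p hp).1 hw
            have h2 := norm_cpow_neg_le (hB p hp).1 hw
            have h3 : (N : ℝ) ≤ p := by exact_mod_cast (hB p hp).2
            have hN' : (0 : ℝ) < N := by exact_mod_cast hN
            have h4 : (1 : ℝ) / p ≤ 1 / N := by gcongr
            calc ‖f p‖ ≤ (1 / N) / (1 / 2) := by
                  rw [hf, norm_div]
                  gcongr
                  exact h2.trans h4
              _ = 2 / N := by ring
        _ = 2 * m / N := by rw [Finset.sum_const, hcard, nsmul_eq_mul]; ring
    rw [hprod]
    have := Finset.norm_prod_one_add_sub_one_le B f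
    have h2 := Real.exp_le_exp.mpr hsum
    linarith
  have hlim : Tendsto (fun N : ℕ => Real.exp (2 * m / N) - 1) atTop (𝓝 0) := by
    have h1 : Tendsto (fun N : ℕ => (2 * m : ℝ) / N) atTop (𝓝 0) :=
      tendsto_const_div_atTop_nhds_zero_nat _
    simpa using ((Real.continuous_exp.tendsto 0).comp h1).sub_const 1
  rw [Metric.tendsto_nhds]
  intro ε hε
  obtain ⟨N, hNε, hN⟩ := ((hlim.eventually (gt_mem_nhds hε)).and (eventually_gt_atTop 0)).exists
  filter_upwards [eventually_primeSetsAtTop m N] with B hB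
  rw [Real.dist_0_eq_abs, abs_norm]
  exact (hbound N hN B hB).trans_lt hNε

/-- Dominated convergence: `|ζ_B| ≤ 2 ^ m` on the line. -/
theorem tendsto_lineIntegral_xiColon (m : ℕ) {c : ℝ} (hc : 1 ≤ c) {s : ℂ} (hs : s.re < c)
    (hs' : 1 - s.re < c) :
    Tendsto (fun B => lineIntegral c fun w => xiColon B w * kernel w s) (primeSetsAtTop m)
      (𝓝 (lineIntegral c fun w => weight m w * kernel w s)) := by
  set M : ℝ := 1 / (c - s.re) + 1 / (c - (1 - s.re)) with hM
  have hk := fun t => norm_kernel_le hs hs' t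
  have hkc := continuous_kernel_linePoint hs hs'
  have hM0 : 0 ≤ M := (norm_nonneg _).trans (hk 0)
  refine MeasureTheory.tendsto_integral_filter_of_dominated_convergence
    (fun t => ‖weight m (linePoint c t) * (2 ^ m * M : ℝ)‖) ?_ ?_ ?_ ?_
  · filter_upwards [eventually_primeSetsAtTop m 0] with B hB
    simp only [xiColon_eq]
    exact ((((continuous_weight_linePoint _ (by linarith)).mul
      (continuous_zetaProd_linePoint (fun p hp => (hB.2 p hp).1) hc)).mul hkc).mul
      continuous_const).aestronglyMeasurable
  · filter_upwards [eventually_primeSetsAtTop m 0] with B hB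
    refine Eventually.of_forall fun t => ?_
    rw [norm_mul, norm_I, mul_one, xiColon_eq, hB.1, mul_assoc, norm_mul, norm_mul, norm_mul,
      norm_real, Real.norm_of_nonneg (by positivity)]
    have h1 := norm_zetaProd_le_two_pow (fun p hp => (hB.2 p hp).1) (w := linePoint c t)
      (by rwa [linePoint_re])
    rw [hB.1] at h1
    gcongr
    exact hk t
  · exact (integrable_weight_mul m hc (φ := fun _ => ((2 ^ m * M : ℝ) : ℂ)) continuous_const
      fun _ => le_rfl).norm
  · refine Eventually.of_forall fun t => ?_
    have h1 := tendsto_zetaProd_one m (w := linePoint c t) (by rwa [linePoint_re])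
    have h2 := ((h1.const_mul (weight m (linePoint c t))).mul_const
      (kernel (linePoint c t) s)).mul_const I
    rw [mul_one] at h2
    refine h2.congr' ?_
    filter_upwards [eventually_primeSetsAtTop m 0] with B hB
    rw [xiColon_eq, hB.1]

end EulerSieve

end

open EulerSieve

theorem theorem3 (m : ℕ) (s₀ : ℂ) (h0 : s₀ ≠ 0) (h1 : s₀ ≠ 1) :
    MeasureTheory.Integrable (fun t : ℝ =>
      linePoint (|s₀.re| + 2) t ^ m * (1 - linePoint (|s₀.re| + 2) t) ^ m *
        g (linePoint (|s₀.re| + 2) t) * kernel (linePoint (|s₀.re| + 2) t) s₀) ∧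
    Tendsto (fun B : Finset ℕ => zetaApprox B s₀) (primeSetsAtTop m)
      (𝓝 (1 / (s₀ ^ m * (1 - s₀) ^ m * g s₀) *
        (1 / (2 * Real.pi * Complex.I) *
          lineIntegral (|s₀.re| + 2) (fun s => s ^ m * (1 - s) ^ m * g s * kernel s s₀)))) := by
  set c : ℝ := |s₀.re| + 2 with hc
  have habs := abs_nonneg s₀.re
  have hc1 : 1 ≤ c := by linarith
  have hs : s₀.re < c := by linarith [le_abs_self s₀.re]
  have hs' : 1 - s₀.re < c := by linarith [neg_abs_le s₀.re]
  refine ⟨integrable_weight_mul m hc1 (continuous_kernel_linePoint hs hs')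
    (norm_kernel_le hs hs'), ?_⟩
  have h := ((tendsto_lineIntegral_xiColon m hc1 hs hs').const_mul
    (1 / (2 * Real.pi * Complex.I))).const_mul (1 / (s₀ ^ m * (1 - s₀) ^ m * g s₀))
  refine h.congr' ?_
  filter_upwards [eventually_primeSetsAtTop m 0] with B hB
  rw [zetaApprox, xiApprox_eq (fun p hp => (hB.2 p hp).1) hc1 hs hs', hB.1, one_div (_ * g s₀),
    mul_inv _ (g s₀)]
  ring
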